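/- **Proposition (Sub-gaussian measurements).** Call a real random variable $x$ sub-gaussian if there is a constant $K>0$ with $(\mathbb E|x|^p)^{1/p}\le K\sqrt p$ for all $p\ge 1$; the smallest such $K$ is its sub-gaussian norm $\|x\|_{\Psi_2}$. A random vector $\mathbf a\in\mathbb R^n$ is sub-gaussian if $\mathbf a^T\mathbf v$ is sub-gaussian for every $\mathbf v\in\mathbb R^n$, its sub-gaussian norm is $\|\mathbf a\|_{\Psi_2}=\sup_{\|\mathbf v\|_2=1}\|\mathbf a^T\mathbf v\|_{\Psi_2}$, and it is isotropic if $\mathbb E[\mathbf a\mathbf a^T]=\mathbf I_n$. For a matrix $\mathbf B$, $\sigma_{\min}(\mathbf B)$ denotes its minimum singular value, and for $\mathbf x_0\in\mathbb R^n$, $\mathbf x_0\ne 0$, put $\bar{\mathbf x}_0=\mathbf x_0/\|\mathbf x_0\|_2$. For every $K$ there are constants $c_1,c_2>0$, depending only on $K$, such that the following holds. Let $\mathbf x_0\in\mathbb R^n$ be a fixed nonzero vector, and let $\mathbf A\in\mathbb R^{m\times n}$ be a random matrix whose rows are independent copies of a random vector $\mathbf a\in\mathbb R^n$ with $\|\mathbf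 a\|_{\Psi_2}\le K$ which is of one of the following forms: 1. $\mathbf a$ is zero-mean, isotropic and sub-gaussian, and $\|\mathbf a\|_2=\sqrt n$ almost surely; or 2. the entries of $\mathbf a$ are independent (not necessarily identically distributed) zero-mean sub-gaussian random variables of unit variance. If $m\le c_1 n$, then with probability at least $1-4\exp(-c_2m)$ we have $\sigma_{\min}(\mathbf A^T)>0$ and $$\frac{\|\mathbf A\bar{\mathbf x}_0\|_2^2}{\sigma_{\min}^2(\mathbf A^T)}\le\frac{2m}{n}.$$ -/

import Mathlib

open MeasureTheory ProbabilityTheory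

/-- `X` is sub-gaussian under `μ`: there is a (finite) constant `K > 0` with
`(E |X| ^ p) ^ (1 / p) ≤ K * √p` for all real `p ≥ 1`. -/
def IsSubgaussian {Ω : Type*} [MeasurableSpace Ω] (X : Ω → ℝ) (μ : Measure Ω) : Prop :=
  ∃ K : ℝ, 0 < K ∧ ∀ p : ℝ, 1 ≤ p →
    eLpNorm X (ENNReal.ofReal p) μ ≤ ENNReal.ofReal (K * √p)

/-- The sub-gaussian norm `‖X‖_{ψ₂}`: the smallest `K` with `(E |X| ^ p) ^ (1 / p) ≤ K * √p`
for all real `p ≥ 1` (it is `∞` when no finite `K` works). -/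
noncomputable def subgaussianNorm {Ω : Type*} [MeasurableSpace Ω] (X : Ω → ℝ)
    (μ : Measure Ω) : ENNReal :=
  sInf {K : ENNReal | ∀ p : ℝ, 1 ≤ p →
    eLpNorm X (ENNReal.ofReal p) μ ≤ K * ENNReal.ofReal (√p)}

/-- A random vector is sub-gaussian if all its one-dimensional marginals are. -/
def IsSubgaussianVec {Ω : Type*} [MeasurableSpace Ω] {n : ℕ}
    (a : Ω → EuclideanSpace ℝ (Fin n)) (μ : Measure Ω) : Prop :=
  ∀ v : EuclideanSpace ℝ (Fin n), IsSubgaussian (fun ω => inner ℝ v (a ω)) μ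

/-- The sub-gaussian norm of a random vector: the supremum over unit vectors `v` of the
sub-gaussian norm of the marginal `⟨v, a⟩`. -/
noncomputable def subgaussianNormVec {Ω : Type*} [MeasurableSpace Ω] {n : ℕ}
    (a : Ω → EuclideanSpace ℝ (Fin n)) (μ : Measure Ω) : ENNReal :=
  ⨆ (v : EuclideanSpace ℝ (Fin n)) (_ : ‖v‖ = 1),
    subgaussianNorm (fun ω => inner ℝ v (a ω)) μ

/-- A random vector is isotropic if `E [a aᵀ]` is the identity matrix. -/
def IsIsotropic {Ω : Type*} [MeasurableSpace Ω] {n : ℕ}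
    (a : Ω → EuclideanSpace ℝ (Fin n)) (μ : Measure Ω) : Prop :=
  (Matrix.of fun i j : Fin n => ∫ ω, a ω i * a ω j ∂μ) = 1

/-- First form of the row vector: zero-mean, isotropic, sub-gaussian, and of Euclidean norm
`√n` almost surely. -/
structure IsSphericalSubgaussianRow {Ω : Type*} [MeasurableSpace Ω] {n : ℕ}
    (a : Ω → EuclideanSpace ℝ (Fin n)) (μ : Measure Ω) : Prop where
  zero_mean : ∀ j : Fin n, ∫ ω, a ω j ∂μ = 0
  isotropic : IsIsotropic a μ
  subgaussian : IsSubgaussianVec a μ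
  norm_eq : ∀ᵐ ω ∂μ, ‖a ω‖ = √(n : ℝ)

/-- Second form of the row vector: independent (not necessarily identically distributed)
entries, each of them zero-mean, of unit variance and sub-gaussian. -/
structure IsIndepSubgaussianRow {Ω : Type*} [MeasurableSpace Ω] {n : ℕ}
    (a : Ω → EuclideanSpace ℝ (Fin n)) (μ : Measure Ω) : Prop where
  indep : iIndepFun (fun (j : Fin n) (ω : Ω) => a ω j) μ
  zero_mean : ∀ j : Fin n, ∫ ω, a ω j ∂μ = 0
  unit_variance : ∀ j : Fin n, variance (fun ω => a ω j) μ = 1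
  subgaussian : ∀ j : Fin n, IsSubgaussian (fun ω => a ω j) μ

/-- The `m × n` matrix whose `i`-th row is `r i`. -/
def rowMatrix {m n : ℕ} (r : Fin m → EuclideanSpace ℝ (Fin n)) : Matrix (Fin m) (Fin n) ℝ :=
  Matrix.of fun i j => r i j

/-- The minimum singular value `σ_min(B)`: the last of the `min p q` singular values of the
`p × q` matrix `B`, listed in decreasing order (Mathlib numbers them from `0`). -/
noncomputable def sigmaMin {p q : ℕ} (B : Matrix (Fin p) (Fin q) ℝ) : ℝ :=
  (Matrix.toEuclideanLin B).singularValues (min p q - 1)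

/-! For a fixed unit vector `u`, the vector `Aᵀu = ∑ uᵢ rᵢ` has mean squared norm `n`, and `‖Aᵀu‖²`
deviates from `n` by more than `n/10` only with probability exponentially small in `n`. A `1/10`-net
of the sphere of `ℝ^m` has at most `21^m` points. If `m` is a small multiple of `n`, a union bound
therefore controls the whole net, and approximation gives `σ_min(Aᵀ) ≥ 0.83 √n`. The numerator is a
sum of `m` independent variables of mean `1`, which stays below `1.3 m` outside an event
exponentially small in `m`. Since `1.3 / 0.83² < 2`, the two estimates give the claim.

The deviation bound for `‖∑ uᵢ rᵢ‖²` is the core (`expMoment_norm_sq_sum_sub_le`). The off-diagonal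
part `∑_{i≠j} uᵢuⱼ⟨rᵢ, rⱼ⟩` is decoupled into inner products of two independent sub-gaussian vectors
(`four_mul_sum_powerset_inner`), whose exponential moments are bounded by comparison with a Gaussian
vector (`expMoment_mul_norm_sq_le`). The diagonal part `∑ uᵢ²(‖rᵢ‖² - n)` is where the two row
models differ: it vanishes almost surely for spherical rows, and for independent entries it is a
Bernstein sum (`expMoment_norm_sq_sub_le`).

All sub-gaussianity enters through one parameter `s`, with `E exp(s⟨v, a⟩²) ≤ 2` for unit `v`.
Exponential moments take values in `[0, ∞]`, so products and Fubini need no integrability. -/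

/-- The exponential moment `E exp f`, as an extended nonnegative real. -/
noncomputable def expMoment {Ω : Type*} [MeasurableSpace Ω] (μ : Measure Ω) (f : Ω → ℝ) :
    ENNReal :=
  ∫⁻ ω, ENNReal.ofReal (Real.exp (f ω)) ∂μ

/-! ### Scalar sub-gaussian and Bernstein moment bounds. -/

lemma exp_le_self_add_exp_sq (x : ℝ) : Real.exp x ≤ x + Real.exp (x ^ 2) := by
  have h1 := Real.add_one_le_exp (x ^ 2)
  rcases le_or_gt |x| 1 with h | h
  · have := (abs_le.1 (Real.abs_exp_sub_one_sub_id_le h)).2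
    linarith
  · rcases lt_abs.1 h with h | h
    · have : Real.exp x ≤ Real.exp (x ^ 2) := Real.exp_le_exp.2 (by nlinarith)
      linarith
    · have : Real.exp x ≤ 1 := Real.exp_le_one_iff.2 (by linarith)
      nlinarith

lemma exp_le_one_add_self_add_sq_mul_exp_abs (y : ℝ) :
    Real.exp y ≤ 1 + y + y ^ 2 * Real.exp |y| := by
  have h1 : 1 ≤ Real.exp |y| := Real.one_le_exp (abs_nonneg y)
  rcases le_or_gt |y| 1 with h | h
  · have := (abs_le.1 (Real.abs_exp_sub_one_sub_id_le h)).2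
    nlinarith [mul_nonneg (sq_nonneg y) (sub_nonneg.2 h1)]
  · rcases lt_abs.1 h with h | h
    · rw [abs_of_pos (by linarith)] at h1 ⊢
      nlinarith [Real.exp_pos y, mul_nonneg (sub_nonneg.2 h1) (by nlinarith : 0 ≤ y ^ 2 - 1)]
    · have : Real.exp y ≤ 1 := Real.exp_le_one_iff.2 (by linarith)
      nlinarith [mul_nonneg (sq_nonneg y) (sub_nonneg.2 h1)]

section Scalar

variable {Ω : Type*} [MeasurableSpace Ω] {μ : Measure Ω}

/-- By convexity `exp(θy) ≤ 1 - θ + θ exp y`, so the moment is at most `1 + θ`. This turns a crude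
bound `2` into one that tends to `1` with `θ`. -/
lemma expMoment_mul_le_exp [IsProbabilityMeasure μ] {Y : Ω → ℝ}
    (h2 : expMoment μ Y ≤ 2) {θ : ℝ} (h0 : 0 ≤ θ) (h1 : θ ≤ 1) :
    expMoment μ (fun ω => θ * Y ω) ≤ ENNReal.ofReal (Real.exp θ) := by
  have key : ∀ y : ℝ, ENNReal.ofReal (Real.exp (θ * y)) ≤
      ENNReal.ofReal (1 - θ) + ENNReal.ofReal θ * ENNReal.ofReal (Real.exp y) := by
    intro y
    rw [← ENNReal.ofReal_mul h0, ← ENNReal.ofReal_add (by linarith) (by positivity)]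
    apply ENNReal.ofReal_le_ofReal
    have := convexOn_exp.2 (Set.mem_univ (0 : ℝ)) (Set.mem_univ y) (sub_nonneg.2 h1) h0 (by ring)
    simpa using this
  calc expMoment μ (fun ω => θ * Y ω)
      ≤ ∫⁻ ω, (ENNReal.ofReal (1 - θ) + ENNReal.ofReal θ * ENNReal.ofReal (Real.exp (Y ω))) ∂μ :=
        lintegral_mono fun ω => key _
    _ = ENNReal.ofReal (1 - θ) + ENNReal.ofReal θ * expMoment μ Y := by
        rw [lintegral_add_left (by fun_prop), lintegral_const_mul' _ _ (by simp)]
        simp [expMoment]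
    _ ≤ ENNReal.ofReal (1 - θ) + ENNReal.ofReal θ * ENNReal.ofReal 2 := by
        gcongr; simpa using h2
    _ = ENNReal.ofReal (1 + θ) := by
        rw [← ENNReal.ofReal_mul h0, ← ENNReal.ofReal_add (by linarith) (by positivity)]
        congr 1; ring
    _ ≤ ENNReal.ofReal (Real.exp θ) := by
        apply ENNReal.ofReal_le_ofReal; linarith [Real.add_one_le_exp θ]

lemma integrable_exp_of_expMoment_lt_top {Y : Ω → ℝ} (hY : AEMeasurable Y μ)
    (h : expMoment μ Y < ⊤) : Integrable (fun ω => Real.exp (Y ω)) μ := by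
  refine ⟨(Real.measurable_exp.comp_aemeasurable hY).aestronglyMeasurable, ?_⟩
  rw [hasFiniteIntegral_iff_ofReal (ae_of_all _ fun ω => (Real.exp_pos _).le)]
  exact h

lemma expMoment_eq_ofReal_integral {Y : Ω → ℝ}
    (h : Integrable (fun ω => Real.exp (Y ω)) μ) :
    expMoment μ Y = ENNReal.ofReal (∫ ω, Real.exp (Y ω) ∂μ) :=
  (ofReal_integral_eq_lintegral_ofReal h (ae_of_all _ fun _ => (Real.exp_pos _).le)).symm

/-- In the exponential series, `E X^(2k) ≤ L^(2k) (2k)^k` and `k^k / k! ≤ e^k` bound the `k`-th term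
by `(2esL²)^k`. The value of `s` makes this `2^(-k)`. -/
lemma expMoment_mul_sq_le_two [IsProbabilityMeasure μ] {X : Ω → ℝ} (hX : AEMeasurable X μ)
    {L : ℝ} (hL : 0 < L)
    (h : ∀ p : ℝ, 1 ≤ p → eLpNorm X (ENNReal.ofReal p) μ ≤ ENNReal.ofReal (L * √p)) :
    expMoment μ (fun ω => 1 / (4 * Real.exp 1 * L ^ 2) * X ω ^ 2) ≤ 2 := by
  set s : ℝ := 1 / (4 * Real.exp 1 * L ^ 2) with hs
  have hs0 : 0 < s := by positivity
  have moment : ∀ k : ℕ, ∫⁻ ω, ENNReal.ofReal (X ω ^ (2 * k)) ∂μ ≤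
      ENNReal.ofReal (L ^ (2 * k) * (2 * k) ^ k) := by
    intro k
    rcases Nat.eq_zero_or_pos k with rfl | hk
    · simp
    have hk1 : (1 : ℝ) ≤ k := by exact_mod_cast hk
    have h2 := h (2 * k) (by linarith)
    have h3 : eLpNorm X (ENNReal.ofReal (2 * k)) μ ^ (2 * k) ≤
        ENNReal.ofReal (L * √(2 * k)) ^ (2 * k) := pow_le_pow_left' h2 _
    have h4 : eLpNorm X (ENNReal.ofReal (2 * k)) μ ^ (2 * k) =
        ∫⁻ ω, ENNReal.ofReal (X ω ^ (2 * k)) ∂μ := by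
      rw [eLpNorm_eq_lintegral_rpow_enorm_toReal (by simp; omega) ENNReal.ofReal_ne_top,
        ENNReal.toReal_ofReal (by positivity), ← ENNReal.rpow_natCast, ← ENNReal.rpow_mul]
      rw [show (1 / (2 * (k : ℝ)) * ((2 * k : ℕ) : ℝ)) = 1 by push_cast; field_simp]
      rw [ENNReal.rpow_one]
      refine lintegral_congr fun ω => ?_
      rw [show (2 * (k : ℝ)) = ((2 * k : ℕ) : ℝ) by push_cast; ring, ENNReal.rpow_natCast,
        Real.enorm_eq_ofReal_abs, ← ENNReal.ofReal_pow (abs_nonneg _),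
        Even.pow_abs (even_two_mul k)]
    rw [← h4]
    refine h3.trans_eq ?_
    rw [← ENNReal.ofReal_pow (by positivity), mul_pow, pow_mul (√(2 * (k : ℝ))),
      Real.sq_sqrt (by positivity)]
  have term : ∀ k : ℕ, ∫⁻ ω, ENNReal.ofReal ((s * X ω ^ 2) ^ k / k.factorial) ∂μ ≤
      ENNReal.ofReal ((1 / 2) ^ k) := by
    intro k
    have e1 : ∀ ω, ENNReal.ofReal ((s * X ω ^ 2) ^ k / k.factorial) =
        ENNReal.ofReal (s ^ k / k.factorial) * ENNReal.ofReal (X ω ^ (2 * k)) := by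
      intro ω
      rw [← ENNReal.ofReal_mul (by positivity)]
      congr 1
      rw [mul_pow, ← pow_mul]; ring
    simp_rw [e1]
    rw [lintegral_const_mul' _ _ (by simp)]
    calc _ ≤ ENNReal.ofReal (s ^ k / k.factorial) * ENNReal.ofReal (L ^ (2 * k) * (2 * k) ^ k) := by
          gcongr; exact moment k
      _ = ENNReal.ofReal ((2 * s * L ^ 2) ^ k * ((k : ℝ) ^ k / k.factorial)) := by
          rw [← ENNReal.ofReal_mul (by positivity)]
          congr 1
          simp only [mul_pow, pow_mul]
          ring
      _ ≤ ENNReal.ofReal ((2 * s * L ^ 2) ^ k * Real.exp 1 ^ k) := by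
          apply ENNReal.ofReal_le_ofReal
          gcongr
          have := Real.pow_div_factorial_le_exp (k : ℝ) (by positivity) k
          rwa [← Real.exp_nat_mul, mul_one]
      _ = _ := by
          rw [← mul_pow]
          congr 2
          rw [hs]; field_simp; norm_num
  have expand : ∀ ω, ENNReal.ofReal (Real.exp (s * X ω ^ 2)) =
      ∑' k : ℕ, ENNReal.ofReal ((s * X ω ^ 2) ^ k / k.factorial) := by
    intro ω
    rw [Real.exp_eq_exp_ℝ, NormedSpace.exp_eq_tsum_div,
      ENNReal.ofReal_tsum_of_nonneg (fun k => by positivity) (Real.summable_pow_div_factorial _)]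
  calc expMoment μ (fun ω => s * X ω ^ 2)
      = ∑' k : ℕ, ∫⁻ ω, ENNReal.ofReal ((s * X ω ^ 2) ^ k / k.factorial) ∂μ := by
        unfold expMoment
        simp_rw [expand]
        exact lintegral_tsum fun k => by fun_prop
    _ ≤ ∑' k : ℕ, ENNReal.ofReal ((1 / 2) ^ k) := ENNReal.tsum_le_tsum term
    _ = ENNReal.ofReal (∑' k : ℕ, (1 / 2 : ℝ) ^ k) :=
        (ENNReal.ofReal_tsum_of_nonneg (fun k => by positivity) summable_geometric_two).symm
    _ = 2 := by rw [tsum_geometric_two]; simp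

variable {X : Ω → ℝ} {s : ℝ}

lemma integrable_sq_of_expMoment (hX : AEMeasurable X μ) (hs : 0 < s)
    (h : expMoment μ (fun ω => s * X ω ^ 2) ≤ 2) : Integrable (fun ω => X ω ^ 2) μ := by
  have hi := integrable_exp_of_expMoment_lt_top (by fun_prop) (h.trans_lt (by simp))
  refine (hi.const_mul (1 / s)).mono (by fun_prop) (ae_of_all _ fun ω => ?_)
  rw [Real.norm_of_nonneg (by positivity), Real.norm_of_nonneg (by positivity),
    div_mul_eq_mul_div, le_div_iff₀ hs]
  linarith [Real.add_one_le_exp (s * X ω ^ 2)]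

variable [IsProbabilityMeasure μ]

lemma integrable_of_expMoment (hX : AEMeasurable X μ) (hs : 0 < s)
    (h : expMoment μ (fun ω => s * X ω ^ 2) ≤ 2) : Integrable X μ := by
  refine ((integrable_sq_of_expMoment hX hs h).add (integrable_const 1)).mono (by fun_prop)
    (ae_of_all _ fun ω => ?_)
  simp only [Pi.add_apply]
  rw [Real.norm_eq_abs, Real.norm_of_nonneg (by positivity)]
  nlinarith [sq_abs (X ω), sq_nonneg (|X ω| - 1)]

lemma expMoment_mul_le_of_centered (hX : AEMeasurable X μ) (hs : 0 < s)
    (h : expMoment μ (fun ω => s * X ω ^ 2) ≤ 2) (h0 : ∫ ω, X ω ∂μ = 0) (t : ℝ) :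
    expMoment μ (fun ω => t * X ω) ≤ ENNReal.ofReal (Real.exp (t ^ 2 / s)) := by
  -- For small `t`, the bound `e^x ≤ x + e^(x²)` is used and the linear term has mean zero. For
  -- large `t`, `tX ≤ t²/(2s) + sX²/2` suffices without centering, since the extra factor `e^(1/2)`
  -- is absorbed by `t²/s ≥ 1`.
  rcases le_or_gt (t ^ 2) s with ht | ht
  · have h1 := expMoment_mul_le_exp h (θ := t ^ 2 / s) (by positivity)
      ((div_le_one hs).2 ht)
    have e : (fun ω => t ^ 2 / s * (s * X ω ^ 2)) = fun ω => (t * X ω) ^ 2 := by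
      ext ω; field_simp
    rw [e] at h1
    have hi := integrable_exp_of_expMoment_lt_top (by fun_prop) (h1.trans_lt (by simp))
    have hXi := (integrable_of_expMoment hX hs h).const_mul t
    refine le_trans ?_ h1
    rw [expMoment_eq_ofReal_integral hi]
    have h2 : ∫ ω, Real.exp ((t * X ω) ^ 2) ∂μ = ∫ ω, (t * X ω + Real.exp ((t * X ω) ^ 2)) ∂μ := by
      rw [integral_add hXi hi, integral_const_mul, h0]; simp
    have h3 : Integrable (fun ω => t * X ω + Real.exp ((t * X ω) ^ 2)) μ := hXi.add hi
    rw [h2, ofReal_integral_eq_lintegral_ofReal h3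
      (ae_of_all _ fun ω => (Real.exp_pos _).le.trans (exp_le_self_add_exp_sq (t * X ω)))]
    exact lintegral_mono fun ω => ENNReal.ofReal_le_ofReal (exp_le_self_add_exp_sq _)
  · have h1 := expMoment_mul_le_exp h (θ := 1 / 2) (by norm_num) (by norm_num)
    calc expMoment μ (fun ω => t * X ω)
        ≤ ∫⁻ ω, ENNReal.ofReal (Real.exp (t ^ 2 / (2 * s))) *
            ENNReal.ofReal (Real.exp (1 / 2 * (s * X ω ^ 2))) ∂μ := by
          refine lintegral_mono fun ω => ?_
          rw [← ENNReal.ofReal_mul (by positivity), ← Real.exp_add]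
          apply ENNReal.ofReal_le_ofReal
          apply Real.exp_le_exp.2
          have : t ^ 2 / (2 * s) + 1 / 2 * (s * X ω ^ 2) - t * X ω
              = (t - s * X ω) ^ 2 / (2 * s) := by field_simp; ring
          have h3 : 0 ≤ (t - s * X ω) ^ 2 / (2 * s) := by positivity
          linarith
      _ = ENNReal.ofReal (Real.exp (t ^ 2 / (2 * s))) *
            expMoment μ (fun ω => 1 / 2 * (s * X ω ^ 2)) := lintegral_const_mul' _ _ (by simp)
      _ ≤ ENNReal.ofReal (Real.exp (t ^ 2 / (2 * s))) * ENNReal.ofReal (Real.exp (1 / 2)) := by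
          gcongr
      _ ≤ _ := by
          rw [← ENNReal.ofReal_mul (by positivity), ← Real.exp_add]
          apply ENNReal.ofReal_le_ofReal
          apply Real.exp_le_exp.2
          have : 1 ≤ t ^ 2 / s := (one_le_div hs).2 ht.le
          have e : t ^ 2 / (2 * s) = t ^ 2 / s / 2 := by field_simp
          rw [e]; linarith

/-- Bernstein's estimate: after a second-order expansion of `exp(lX²)`, the unit second moment gives
the linear term `l`, which the factor `exp(-l)` cancels. -/
lemma expMoment_mul_sq_sub_one_le (hX : AEMeasurable X μ) (hs : 0 < s)
    (h : expMoment μ (fun ω => s * X ω ^ 2) ≤ 2) (h1 : ∫ ω, X ω ^ 2 ∂μ = 1) {l : ℝ}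
    (hl : |l| ≤ s / 2) :
    expMoment μ (fun ω => l * (X ω ^ 2 - 1)) ≤ ENNReal.ofReal (Real.exp (16 * l ^ 2 / s ^ 2)) := by
  have hi := integrable_exp_of_expMoment_lt_top (by fun_prop) (h.trans_lt (by simp))
  have hXi := integrable_sq_of_expMoment hX hs h
  have hle : ∫ ω, Real.exp (s * X ω ^ 2) ∂μ ≤ 2 := by
    rw [expMoment_eq_ofReal_integral hi, ENNReal.ofReal_le_iff_le_toReal (by simp)] at h
    simpa using h
  have pt : ∀ x : ℝ, Real.exp (l * x ^ 2) ≤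
      1 + l * x ^ 2 + 8 * l ^ 2 / s ^ 2 * Real.exp (s * x ^ 2) := by
    intro x
    refine (exp_le_one_add_self_add_sq_mul_exp_abs _).trans ?_
    gcongr 1 + l * x ^ 2 + ?_
    -- The factor `exp(sx²)` is split in two halves: one dominates `exp|lx²|`, the other dominates
    -- `x⁴`.
    have a1 : |l * x ^ 2| ≤ s * x ^ 2 / 2 := by
      rw [abs_mul, abs_of_nonneg (sq_nonneg x)]
      nlinarith [sq_nonneg x]
    have a2 : (s * x ^ 2 / 2) ^ 2 / 2 ≤ Real.exp (s * x ^ 2 / 2) := by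
      have := Real.quadratic_le_exp_of_nonneg (x := s * x ^ 2 / 2) (by positivity)
      have : 0 ≤ s * x ^ 2 / 2 := by positivity
      linarith
    have a3 : (x ^ 2) ^ 2 ≤ 8 / s ^ 2 * Real.exp (s * x ^ 2 / 2) := by
      rw [div_mul_eq_mul_div, le_div_iff₀ (by positivity)]
      nlinarith
    calc (l * x ^ 2) ^ 2 * Real.exp |l * x ^ 2|
        ≤ l ^ 2 * (8 / s ^ 2 * Real.exp (s * x ^ 2 / 2)) * Real.exp (s * x ^ 2 / 2) := by
          rw [mul_pow]; gcongr
      _ = 8 * l ^ 2 / s ^ 2 * (Real.exp (s * x ^ 2 / 2) * Real.exp (s * x ^ 2 / 2)) := by ring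
      _ = _ := by rw [← Real.exp_add]; ring_nf
  have hint1 : Integrable (fun ω => 1 + l * X ω ^ 2) μ := (integrable_const 1).add (hXi.const_mul l)
  have hint : Integrable (fun ω => 1 + l * X ω ^ 2 + 8 * l ^ 2 / s ^ 2 * Real.exp (s * X ω ^ 2)) μ :=
    hint1.add (hi.const_mul _)
  have step : expMoment μ (fun ω => l * X ω ^ 2) ≤
      ENNReal.ofReal (Real.exp (l + 16 * l ^ 2 / s ^ 2)) := by
    calc expMoment μ (fun ω => l * X ω ^ 2)
        ≤ ∫⁻ ω, ENNReal.ofReal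
            (1 + l * X ω ^ 2 + 8 * l ^ 2 / s ^ 2 * Real.exp (s * X ω ^ 2)) ∂μ :=
          lintegral_mono fun ω => ENNReal.ofReal_le_ofReal (pt _)
      _ = ENNReal.ofReal (∫ ω, (1 + l * X ω ^ 2 +
            8 * l ^ 2 / s ^ 2 * Real.exp (s * X ω ^ 2)) ∂μ) :=
          (ofReal_integral_eq_lintegral_ofReal hint
            (ae_of_all _ fun ω => (Real.exp_pos _).le.trans (pt _))).symm
      _ ≤ _ := by
          apply ENNReal.ofReal_le_ofReal
          rw [integral_add hint1 (hi.const_mul _),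
            integral_add (integrable_const 1) (hXi.const_mul l), integral_const_mul,
            integral_const_mul, h1]
          have : 8 * l ^ 2 / s ^ 2 * ∫ ω, Real.exp (s * X ω ^ 2) ∂μ ≤ 8 * l ^ 2 / s ^ 2 * 2 := by
            gcongr
          have e : 8 * l ^ 2 / s ^ 2 * 2 = 16 * l ^ 2 / s ^ 2 := by ring
          have := Real.add_one_le_exp (l + 16 * l ^ 2 / s ^ 2)
          simp
          linarith
  calc expMoment μ (fun ω => l * (X ω ^ 2 - 1))
      = ∫⁻ ω, ENNReal.ofReal (Real.exp (-l)) * ENNReal.ofReal (Real.exp (l * X ω ^ 2)) ∂μ := by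
        refine lintegral_congr fun ω => ?_
        rw [← ENNReal.ofReal_mul (by positivity), ← Real.exp_add]
        ring_nf
    _ = ENNReal.ofReal (Real.exp (-l)) * expMoment μ (fun ω => l * X ω ^ 2) :=
        lintegral_const_mul' _ _ (by simp)
    _ ≤ ENNReal.ofReal (Real.exp (-l)) * ENNReal.ofReal (Real.exp (l + 16 * l ^ 2 / s ^ 2)) := by
        gcongr
    _ = _ := by
        rw [← ENNReal.ofReal_mul (by positivity), ← Real.exp_add]
        ring_nf

end Scalar

/-! ### Nets of the unit sphere. -/

section Net

variable {E : Type*} [NormedAddCommGroup E] [NormedSpace ℝ E]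

/-- A linear map which nearly preserves the norm, up to the scale `ρ`, on a `1/10`-net of the unit
sphere is bounded below on the whole space. -/
lemma lower_bound_of_net {F : Type*} [NormedAddCommGroup F] [NormedSpace ℝ F]
    (T : E →L[ℝ] F) {N : Finset E} (hN : ∀ u : E, ‖u‖ = 1 → ∃ c ∈ N, ‖u - c‖ ≤ 1 / 10) {ρ : ℝ}
    (hρ : 0 ≤ ρ) (h : ∀ c ∈ N, |‖T c‖ ^ 2 - ρ ^ 2| ≤ ρ ^ 2 / 10) (u : E) :
    83 / 100 * ρ * ‖u‖ ≤ ‖T u‖ := by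
  have hup : ∀ c ∈ N, ‖T c‖ ≤ 1.05 * ρ := fun c hc => by
    have := (abs_le.1 (h c hc)).2
    exact le_of_sq_le_sq (by nlinarith [sq_nonneg ρ]) (by positivity)
  have hlo : ∀ c ∈ N, 0.948 * ρ ≤ ‖T c‖ := fun c hc => by
    have := (abs_le.1 (h c hc)).1
    exact le_of_sq_le_sq (by nlinarith [sq_nonneg ρ]) (norm_nonneg _)
  have hdiff : ∀ v c : E, ‖v - c‖ ≤ 1 / 10 → ‖T v - T c‖ ≤ ‖T‖ / 10 := fun v c hvc => by
    rw [← map_sub]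
    refine (T.le_opNorm _).trans ?_
    nlinarith [norm_nonneg T]
  -- The bound on `‖T‖` is self-referential; solving it gives `‖T‖ ≤ (1.05 / 0.9) ρ`. The lower
  -- bound is then `0.948 ρ - ‖T‖/10 ≥ 0.83 ρ`.
  have hop : ‖T‖ ≤ 1.05 * ρ + ‖T‖ / 10 := by
    refine T.opNorm_le_of_unit_norm (by positivity) fun v hv => ?_
    obtain ⟨c, hc, hvc⟩ := hN v hv
    have := norm_add_le (T c) (T v - T c)
    rw [add_sub_cancel] at this
    linarith [hup c hc, hdiff v c hvc]
  have unit : ∀ v : E, ‖v‖ = 1 → 83 / 100 * ρ ≤ ‖T v‖ := fun v hv => by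
    obtain ⟨c, hc, hvc⟩ := hN v hv
    have := norm_sub_le (T v) (T v - T c)
    rw [sub_sub_cancel] at this
    linarith [hlo c hc, hdiff v c hvc]
  rcases eq_or_ne u 0 with rfl | hu
  · simp
  have hu' : 0 < ‖u‖ := norm_pos_iff.2 hu
  have := unit (‖u‖⁻¹ • u) (by rw [norm_smul, norm_inv, norm_norm, inv_mul_cancel₀ hu'.ne'])
  rw [map_smul, norm_smul, norm_inv, norm_norm, inv_mul_eq_div, le_div_iff₀ hu'] at this
  exact this

variable [FiniteDimensional ℝ E]

/-- Volume comparison: the disjoint balls of radius `1/20` around the points lie in the ball of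
radius `21/20`. -/
lemma card_le_of_separated_tenth (t : Finset E) (ht : ∀ c ∈ t, ‖c‖ = 1)
    (h : ∀ c ∈ t, ∀ d ∈ t, c ≠ d → 1 / 10 < ‖c - d‖) : t.card ≤ 21 ^ Module.finrank ℝ E := by
  borelize E
  let μ : Measure E := Measure.addHaar
  have D : Set.Pairwise (t : Set E)
      (Function.onFun Disjoint fun c => Metric.ball (c : E) (1 / 20)) := by
    rintro c hc d hd hcd
    apply Metric.ball_disjoint_ball
    rw [dist_eq_norm]
    linarith [h c hc d hd hcd]
  have A_subset : (⋃ c ∈ t, Metric.ball (c : E) (1 / 20)) ⊆ Metric.ball (0 : E) (21 / 20) := by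
    refine Set.iUnion₂_subset fun x hx => ?_
    apply Metric.ball_subset_ball'
    rw [dist_zero_right, ht x hx]; norm_num
  have I : (t.card : ENNReal) * ENNReal.ofReal ((1 / 20) ^ Module.finrank ℝ E) *
      μ (Metric.ball 0 1) ≤ ENNReal.ofReal ((21 / 20) ^ Module.finrank ℝ E) * μ (Metric.ball 0 1) :=
    calc
      _ = μ (⋃ c ∈ t, Metric.ball (c : E) (1 / 20)) := by
        rw [measure_biUnion_finset D fun c _ => measurableSet_ball]
        simp only [μ.addHaar_ball_of_pos _ (by norm_num : (0 : ℝ) < 1 / 20)]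
        simp only [Finset.sum_const, nsmul_eq_mul, mul_assoc]
      _ ≤ μ (Metric.ball (0 : E) (21 / 20)) := measure_mono A_subset
      _ = _ := by
        simp only [μ.addHaar_ball_of_pos _ (by norm_num : (0 : ℝ) < 21 / 20)]
  have J := (ENNReal.mul_le_mul_iff_left (Metric.measure_ball_pos μ (0 : E) zero_lt_one).ne'
    measure_ball_lt_top.ne).1 I
  have K : (t.card : ℝ) ≤ (21 : ℝ) ^ Module.finrank ℝ E := by
    have := ENNReal.toReal_le_of_le_ofReal (by positivity) J
    rw [ENNReal.toReal_mul, ENNReal.toReal_natCast, ENNReal.toReal_ofReal (by positivity),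
      div_pow, div_pow, one_pow, mul_one_div] at this
    exact (div_le_div_iff_of_pos_right (by positivity)).1 this
  exact_mod_cast K

/-- A separated set of maximal cardinality is a net, because a point far from all its members could
be added to it. -/
lemma exists_net_unit_sphere : ∃ N : Finset E, N.card ≤ 21 ^ Module.finrank ℝ E ∧
    (∀ c ∈ N, ‖c‖ = 1) ∧ ∀ u : E, ‖u‖ = 1 → ∃ c ∈ N, ‖u - c‖ ≤ 1 / 10 := by
  classical
  let S : ℕ → Prop := fun k => ∃ N : Finset E, N.card = k ∧ (∀ c ∈ N, ‖c‖ = 1) ∧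
    ∀ c ∈ N, ∀ d ∈ N, c ≠ d → 1 / 10 < ‖c - d‖
  have h0 : S 0 := ⟨∅, by simp⟩
  have hb : ∀ k, S k → k ≤ 21 ^ Module.finrank ℝ E := by
    rintro k ⟨N, rfl, h1, h2⟩
    exact card_le_of_separated_tenth N h1 h2
  obtain ⟨N, hN, h1, h2⟩ : S (Nat.findGreatest S (21 ^ Module.finrank ℝ E)) :=
    Nat.findGreatest_spec (Nat.zero_le _) h0
  refine ⟨N, card_le_of_separated_tenth N h1 h2, h1, fun u hu => ?_⟩
  by_contra! hcon
  have huN : u ∉ N := fun hmem => by have := hcon u hmem; simp at this; linarith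
  have hS : S (N.card + 1) := by
    refine ⟨insert u N, Finset.card_insert_of_notMem huN, ?_, ?_⟩
    · intro c hc
      rcases Finset.mem_insert.1 hc with rfl | hc
      exacts [hu, h1 c hc]
    · intro c hc' d hd' hcd
      rcases Finset.mem_insert.1 hc' with rfl | hc <;> rcases Finset.mem_insert.1 hd' with rfl | hd
      · exact absurd rfl hcd
      · exact hcon d hd
      · rw [norm_sub_rev]; exact hcon c hc
      · exact h2 c hc d hd hcd
  have := Nat.le_findGreatest (hb _ hS) hS
  omega

end Net

/-! ### Singular values and decoupling. -/

/-- An eigenvector `v` of `T*T` for the eigenvalue `σᵢ²` satisfies `‖Tv‖ = σᵢ‖v‖`. -/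
lemma le_singularValues_of_le_norm {E F : Type*} [NormedAddCommGroup E] [InnerProductSpace ℝ E]
    [FiniteDimensional ℝ E] [NormedAddCommGroup F] [InnerProductSpace ℝ F] [FiniteDimensional ℝ F]
    (T : E →ₗ[ℝ] F) {κ : ℝ} (h : ∀ u, κ * ‖u‖ ≤ ‖T u‖) {i : ℕ}
    (hi : i < Module.finrank ℝ E) : κ ≤ T.singularValues i := by
  obtain ⟨v, hv⟩ := (T.hasEigenvalue_adjoint_comp_self_sq_singularValues hi).exists_hasEigenvector
  have h1 : T.adjoint (T v) = (T.singularValues i ^ 2) • v := hv.apply_eq_smul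
  have h2 : ‖T v‖ ^ 2 = (T.singularValues i * ‖v‖) ^ 2 := by
    rw [← real_inner_self_eq_norm_sq, ← LinearMap.adjoint_inner_left, h1, real_inner_smul_left,
      real_inner_self_eq_norm_sq, mul_pow]
  have h3 : ‖T v‖ = T.singularValues i * ‖v‖ :=
    (pow_left_inj₀ (norm_nonneg _) (mul_nonneg (T.singularValues_nonneg i) (norm_nonneg _))
      two_ne_zero).1 h2
  have := h v
  rw [h3] at this
  exact le_of_mul_le_mul_right this (norm_pos_iff.2 hv.2)

lemma le_sigmaMin_of_le_norm {p q : ℕ} (B : Matrix (Fin p) (Fin q) ℝ) (hq : 0 < q) (hqp : q ≤ p)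
    {κ : ℝ} (h : ∀ u, κ * ‖u‖ ≤ ‖Matrix.toEuclideanLin B u‖) : κ ≤ sigmaMin B := by
  apply le_singularValues_of_le_norm _ h
  rw [finrank_euclideanSpace_fin, min_eq_right hqp]
  omega

/-- Decoupling: the off-diagonal part of `‖∑ y i‖ ^ 2` is four times the average of
`⟪∑ i ∈ T, y i, ∑ i ∉ T, y i⟫` over all subsets `T`. -/
lemma four_mul_sum_powerset_inner {ι E : Type*} [DecidableEq ι] [NormedAddCommGroup E]
    [InnerProductSpace ℝ E] (y : ι → E) (S : Finset ι) :
    4 * ∑ T ∈ S.powerset, inner ℝ (∑ i ∈ T, y i) (∑ i ∈ S \ T, y i) =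
      2 ^ S.card * (‖∑ i ∈ S, y i‖ ^ 2 - ∑ i ∈ S, ‖y i‖ ^ 2) := by
  induction S using Finset.induction_on with
  | empty => simp
  | insert a S ha ih =>
    -- The subsets of `insert a S` come in pairs `T`, `insert a T`. The cross terms of `y a` within
    -- a pair add up to its inner product with the full sum over `S`, whatever `T` is.
    have key : ∀ T ∈ S.powerset,
        inner ℝ (∑ i ∈ T, y i) (∑ i ∈ insert a S \ T, y i) +
          inner ℝ (∑ i ∈ insert a T, y i) (∑ i ∈ insert a S \ insert a T, y i) =
        2 * inner ℝ (∑ i ∈ T, y i) (∑ i ∈ S \ T, y i) + inner ℝ (y a) (∑ i ∈ S, y i) := by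
      intro T hT
      have hTS := Finset.mem_powerset.1 hT
      have haT : a ∉ T := fun h => ha (hTS h)
      have e1 : insert a S \ T = insert a (S \ T) := Finset.insert_sdiff_of_notMem _ haT
      have e2 : insert a S \ insert a T = S \ T := by
        ext i; by_cases h : i = a <;> simp [h, ha]
      rw [e1, e2, Finset.sum_insert (by simp [ha]), Finset.sum_insert haT,
        ← Finset.sum_sdiff hTS, inner_add_right, inner_add_left, inner_add_right,
        real_inner_comm (y a) (∑ i ∈ T, y i)]
      ring
    rw [Finset.sum_powerset_insert ha, ← Finset.sum_add_distrib, Finset.sum_congr rfl key,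
      Finset.sum_add_distrib, ← Finset.mul_sum, Finset.sum_const, Finset.card_powerset,
      Finset.sum_insert ha, Finset.sum_insert ha, Finset.card_insert_of_notMem ha,
      norm_add_sq_real, nsmul_eq_mul]
    push_cast
    linear_combination 2 * ih

/-! ### Chernoff's bound and exponential moments of independent sums. -/

section Independence

variable {Ω : Type*} [MeasurableSpace Ω] {μ : Measure Ω}

lemma measure_ge_le_exp_mul_expMoment {f : Ω → ℝ} (hf : AEMeasurable f μ) (a : ℝ) :
    μ {ω | a ≤ f ω} ≤ ENNReal.ofReal (Real.exp (-a)) * expMoment μ f := by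
  have h := meas_ge_le_lintegral_div (μ := μ) (f := fun ω => ENNReal.ofReal (Real.exp (f ω)))
    (by fun_prop) (ε := ENNReal.ofReal (Real.exp a)) (by simp [Real.exp_pos]) (by simp)
  have e : {ω | a ≤ f ω} = {ω | ENNReal.ofReal (Real.exp a) ≤ ENNReal.ofReal (Real.exp (f ω))} := by
    ext ω
    simp [ENNReal.ofReal_le_ofReal_iff (Real.exp_pos _).le]
  rw [e]
  refine h.trans_eq ?_
  rw [ENNReal.div_eq_inv_mul, ← ENNReal.ofReal_inv_of_pos (Real.exp_pos _), ← Real.exp_neg]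
  rfl

lemma expMoment_sum_of_iIndepFun {ι : Type*} (S : Finset ι) {f : ι → Ω → ℝ}
    (hf : ∀ i, Measurable (f i)) (h : iIndepFun f μ) :
    expMoment μ (fun ω => ∑ i ∈ S, f i ω) = ∏ i ∈ S, expMoment μ (f i) := by
  have h' : iIndepFun (fun i ω => ENNReal.ofReal (Real.exp (f i ω))) μ :=
    h.comp (fun _ x => ENNReal.ofReal (Real.exp x)) fun _ => by fun_prop
  unfold expMoment
  rw [← lintegral_prod_eq_prod_lintegral_of_indepFun S _ h' fun i => by fun_prop]
  refine lintegral_congr fun ω => ?_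
  rw [Real.exp_sum, ENNReal.ofReal_prod_of_nonneg fun _ _ => (Real.exp_pos _).le]

lemma expMoment_sum_le_of_iIndepFun {ι : Type*} (S : Finset ι) {f : ι → Ω → ℝ}
    (hf : ∀ i, Measurable (f i)) (h : iIndepFun f μ) {b : ι → ℝ}
    (hb : ∀ i, expMoment μ (f i) ≤ ENNReal.ofReal (Real.exp (b i))) :
    expMoment μ (fun ω => ∑ i ∈ S, f i ω) ≤ ENNReal.ofReal (Real.exp (∑ i ∈ S, b i)) := by
  rw [expMoment_sum_of_iIndepFun S hf h, Real.exp_sum,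
    ENNReal.ofReal_prod_of_nonneg fun _ _ => (Real.exp_pos _).le]
  exact Finset.prod_le_prod' fun i _ => hb i

end Independence

/-! ### Comparison with a Gaussian vector. -/

section Gaussian

lemma expMoment_gaussianReal_mul (t : ℝ) :
    expMoment (gaussianReal 0 1) (fun x => t * x) = ENNReal.ofReal (Real.exp (t ^ 2 / 2)) := by
  rw [expMoment_eq_ofReal_integral (integrable_exp_mul_gaussianReal t)]
  have := congrFun (mgf_id_gaussianReal (μ := 0) (v := 1)) t
  simp only [mgf, id] at this
  rw [this]
  simp

lemma expMoment_gaussianReal_sq : expMoment (gaussianReal 0 1) (fun x => x ^ 2 / 4) ≤ 2 := by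
  unfold expMoment
  rw [gaussianReal_of_var_ne_zero _ one_ne_zero,
    lintegral_withDensity_eq_lintegral_mul _ (measurable_gaussianPDF _ _) (by fun_prop)]
  have e : ∀ x : ℝ, (gaussianPDF 0 1 * fun x => ENNReal.ofReal (Real.exp (x ^ 2 / 4))) x =
      ENNReal.ofReal ((√(2 * Real.pi))⁻¹ * Real.exp (-(1 / 4) * x ^ 2)) := by
    intro x
    rw [Pi.mul_apply, gaussianPDF, ← ENNReal.ofReal_mul (gaussianPDFReal_nonneg _ _ _),
      gaussianPDFReal, mul_assoc, ← Real.exp_add]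
    congr 2
    · simp
    · congr 1; simp; ring
  simp_rw [e]
  rw [← ofReal_integral_eq_lintegral_ofReal
    ((integrable_exp_neg_mul_sq (by norm_num)).const_mul _) (ae_of_all _ fun x => by positivity),
    integral_const_mul, integral_gaussian, ← Real.sqrt_inv, ← Real.sqrt_mul (by positivity)]
  have : (2 * Real.pi)⁻¹ * (Real.pi / (1 / 4)) = 2 := by
    have := Real.pi_pos.ne'
    field_simp; norm_num
  rw [this, ENNReal.ofReal_le_iff_le_toReal (by simp)]
  rw [Real.sqrt_le_left (by simp)]
  norm_num

variable {Ω : Type*} [MeasurableSpace Ω] {μ : Measure Ω} [IsProbabilityMeasure μ] {n : ℕ} {s : ℝ}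

/-- A random vector with sub-gaussian marginals has a finite exponential moment of its squared
norm, by comparison with a Gaussian vector. -/
lemma expMoment_mul_norm_sq_le {Z : Ω → EuclideanSpace ℝ (Fin n)} (hZ : Measurable Z)
    (hs : 0 < s) (h : ∀ v : EuclideanSpace ℝ (Fin n),
      expMoment μ (fun ω => inner ℝ v (Z ω)) ≤ ENNReal.ofReal (Real.exp (‖v‖ ^ 2 / s)))
    {b : ℝ} (hb : 0 ≤ b) (hbs : 8 * b ≤ s) :
    expMoment μ (fun ω => b * ‖Z ω‖ ^ 2) ≤ ENNReal.ofReal (Real.exp (8 * b / s * n)) := by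
  let G : Measure (Fin n → ℝ) := Measure.pi fun _ => gaussianReal 0 1
  have hind : iIndepFun (fun (j : Fin n) (w : Fin n → ℝ) => w j) G :=
    iIndepFun_pi (μ := fun _ : Fin n => gaussianReal 0 1) (X := fun _ x => x)
      fun _ => aemeasurable_id
  have hmarg : ∀ (j : Fin n) (f : ℝ → ℝ), Measurable f →
      expMoment G (fun w => f (w j)) = expMoment (gaussianReal 0 1) f := fun j f hf =>
    (measurePreserving_eval (fun _ : Fin n => gaussianReal 0 1) j).lintegral_comp
      (f := fun x => ENNReal.ofReal (Real.exp (f x))) (by fun_prop)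
  -- The Gaussian moment generating function writes `exp(b‖z‖²)` as an average of exponentials of
  -- linear forms in `z`. After exchanging the integrals, only the marginal hypothesis on `Z` is
  -- needed.
  have hz : ∀ z : EuclideanSpace ℝ (Fin n), ENNReal.ofReal (Real.exp (b * ‖z‖ ^ 2)) =
      expMoment G (fun w => inner ℝ (√(2 * b) • WithLp.toLp 2 w) z) := by
    intro z
    have e : (fun w : Fin n → ℝ => inner ℝ (√(2 * b) • WithLp.toLp 2 w) z) =
        fun w => ∑ j, (√(2 * b) * z j) * w j := by
      ext w
      rw [real_inner_smul_left, PiLp.inner_apply, Finset.mul_sum]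
      refine Finset.sum_congr rfl fun j _ => ?_
      simp; ring
    rw [e, expMoment_sum_of_iIndepFun (f := fun j (w : Fin n → ℝ) => (√(2 * b) * z j) * w j) _
      (by fun_prop)
      (hind.comp (fun j x => (√(2 * b) * z j) * x) fun j => by fun_prop)]
    have e2 : ∀ j, expMoment G (fun w => (√(2 * b) * z j) * w j) =
        ENNReal.ofReal (Real.exp ((√(2 * b) * z j) ^ 2 / 2)) := fun j => by
      rw [hmarg j (fun x => (√(2 * b) * z j) * x) (by fun_prop), expMoment_gaussianReal_mul]
    simp_rw [e2]
    rw [← ENNReal.ofReal_prod_of_nonneg fun _ _ => (Real.exp_pos _).le, ← Real.exp_sum,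
      EuclideanSpace.norm_sq_eq, Finset.mul_sum]
    congr 3
    ext j
    rw [mul_pow, Real.sq_sqrt (by positivity), Real.norm_eq_abs, sq_abs]
    ring
  calc expMoment μ (fun ω => b * ‖Z ω‖ ^ 2)
      = ∫⁻ ω, ∫⁻ w, ENNReal.ofReal
          (Real.exp (inner ℝ (√(2 * b) • WithLp.toLp 2 w) (Z ω))) ∂G ∂μ :=
        lintegral_congr fun ω => hz (Z ω)
    _ = ∫⁻ w, ∫⁻ ω, ENNReal.ofReal
          (Real.exp (inner ℝ (√(2 * b) • WithLp.toLp 2 w) (Z ω))) ∂μ ∂G := by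
        apply lintegral_lintegral_swap
        apply Measurable.aemeasurable
        unfold Function.uncurry
        fun_prop
    _ ≤ ∫⁻ w, ENNReal.ofReal (Real.exp (‖√(2 * b) • WithLp.toLp 2 w‖ ^ 2 / s)) ∂G :=
        lintegral_mono fun w => h _
    -- The exponent `2b‖w‖²/s` is written with `wⱼ²/4`, whose Gaussian exponential moment is at most
    -- `2`; hence the condition `8b ≤ s`.
    _ = expMoment G (fun w => ∑ j, (8 * b / s) * (w j ^ 2 / 4)) := by
        refine lintegral_congr fun w => ?_
        congr 2
        rw [norm_smul, mul_pow, Real.norm_eq_abs, sq_abs, Real.sq_sqrt (by positivity),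
          EuclideanSpace.norm_sq_eq, Finset.mul_sum, Finset.sum_div]
        refine Finset.sum_congr rfl fun j _ => ?_
        rw [Real.norm_eq_abs, sq_abs]
        ring
    _ ≤ ENNReal.ofReal (Real.exp (∑ _j : Fin n, 8 * b / s)) := by
        refine expMoment_sum_le_of_iIndepFun Finset.univ
          (f := fun j (w : Fin n → ℝ) => (8 * b / s) * (w j ^ 2 / 4)) (fun j => by fun_prop)
          (hind.comp (fun j x => (8 * b / s) * (x ^ 2 / 4)) fun j => by fun_prop) fun j => ?_
        rw [hmarg j (fun x => (8 * b / s) * (x ^ 2 / 4)) (by fun_prop)]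
        exact expMoment_mul_le_exp expMoment_gaussianReal_sq (by positivity)
          ((div_le_one hs).2 hbs)
    _ = _ := by
        simp only [Finset.sum_const, Finset.card_univ, Fintype.card_fin, nsmul_eq_mul]
        rw [mul_comm]

/-- Integrating over `X` with `Z` frozen leaves `exp((c²/s)‖Z‖²)`, to which
`expMoment_mul_norm_sq_le` applies with `b = c²/s`. -/
lemma expMoment_mul_inner_le_of_indepFun {X Z : Ω → EuclideanSpace ℝ (Fin n)} (hX : Measurable X)
    (hZ : Measurable Z) (hXZ : IndepFun X Z μ) (hs : 0 < s)
    (h : ∀ v : EuclideanSpace ℝ (Fin n),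
      expMoment μ (fun ω => inner ℝ v (X ω)) ≤ ENNReal.ofReal (Real.exp (‖v‖ ^ 2 / s)))
    (h' : ∀ v : EuclideanSpace ℝ (Fin n),
      expMoment μ (fun ω => inner ℝ v (Z ω)) ≤ ENNReal.ofReal (Real.exp (‖v‖ ^ 2 / s)))
    {c : ℝ} (hc : 8 * c ^ 2 ≤ s ^ 2) :
    expMoment μ (fun ω => c * inner ℝ (X ω) (Z ω)) ≤
      ENNReal.ofReal (Real.exp (8 * c ^ 2 / s ^ 2 * n)) := by
  have hprod := (indepFun_iff_map_prod_eq_prod_map_map hX.aemeasurable hZ.aemeasurable).1 hXZ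
  have hm : Measurable (fun p : EuclideanSpace ℝ (Fin n) × EuclideanSpace ℝ (Fin n) =>
      ENNReal.ofReal (Real.exp (c * inner ℝ p.1 p.2))) := by fun_prop
  calc expMoment μ (fun ω => c * inner ℝ (X ω) (Z ω))
      = ∫⁻ p, ENNReal.ofReal (Real.exp (c * inner ℝ p.1 p.2)) ∂(μ.map fun ω => (X ω, Z ω)) :=
        (lintegral_map hm (hX.prodMk hZ)).symm
    _ = ∫⁻ z, ∫⁻ x, ENNReal.ofReal (Real.exp (c * inner ℝ x z)) ∂(μ.map X) ∂(μ.map Z) := by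
        have := Measure.isProbabilityMeasure_map (μ := μ) hX.aemeasurable
        have := Measure.isProbabilityMeasure_map (μ := μ) hZ.aemeasurable
        rw [hprod, lintegral_prod_symm _ hm.aemeasurable]
    _ = ∫⁻ ω', ∫⁻ ω, ENNReal.ofReal (Real.exp (c * inner ℝ (X ω) (Z ω'))) ∂μ ∂μ := by
        have := Measure.isProbabilityMeasure_map (μ := μ) hX.aemeasurable
        rw [lintegral_map (Measurable.lintegral_prod_left' hm) hZ]
        refine lintegral_congr fun ω' => ?_
        rw [lintegral_map (by fun_prop) hX]
    _ ≤ ∫⁻ ω', ENNReal.ofReal (Real.exp (c ^ 2 / s * ‖Z ω'‖ ^ 2)) ∂μ := by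
        refine lintegral_mono fun ω' => ?_
        have := h (c • Z ω')
        rw [norm_smul, mul_pow, Real.norm_eq_abs, sq_abs] at this
        rw [div_mul_eq_mul_div]
        refine le_trans (le_of_eq (lintegral_congr fun ω => ?_)) this
        beta_reduce
        rw [real_inner_smul_left, real_inner_comm]
    _ ≤ ENNReal.ofReal (Real.exp (8 * (c ^ 2 / s) / s * n)) := by
        refine expMoment_mul_norm_sq_le hZ hs h' (by positivity) ?_
        rw [← mul_div_assoc, div_le_iff₀ hs]
        linarith
    _ = _ := by congr 2; field_simp

end Gaussian

/-! ### Exponential moments of `‖∑ uᵢ rᵢ‖² - n` for a fixed unit vector `u`. -/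

section Rows

variable {Ω : Type*} [MeasurableSpace Ω] {μ : Measure Ω}
  {m n : ℕ} {s : ℝ} {r : Fin m → Ω → EuclideanSpace ℝ (Fin n)}

/-- Partial sums over any `T` keep the constant `s`, because `∑_{i∈T} uᵢ² ≤ 1`. This is what both
halves of the decoupled form require. -/
lemma expMoment_inner_sum_smul_le (hr : ∀ i, Measurable (r i)) (hind : iIndepFun r μ) (hs : 0 < s)
    (h : ∀ i (v : EuclideanSpace ℝ (Fin n)),
      expMoment μ (fun ω => inner ℝ v (r i ω)) ≤ ENNReal.ofReal (Real.exp (‖v‖ ^ 2 / s)))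
    (u : EuclideanSpace ℝ (Fin m)) (hu : ‖u‖ = 1) (T : Finset (Fin m))
    (v : EuclideanSpace ℝ (Fin n)) :
    expMoment μ (fun ω => inner ℝ v (∑ i ∈ T, u i • r i ω)) ≤
      ENNReal.ofReal (Real.exp (‖v‖ ^ 2 / s)) := by
  have e : (fun ω => inner ℝ v (∑ i ∈ T, u i • r i ω)) =
      fun ω => ∑ i ∈ T, inner ℝ (u i • v) (r i ω) := by
    ext ω
    rw [inner_sum]
    refine Finset.sum_congr rfl fun i _ => ?_
    rw [real_inner_smul_left, real_inner_smul_right]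
  rw [e]
  refine (expMoment_sum_le_of_iIndepFun T (f := fun i ω => inner ℝ (u i • v) (r i ω))
    (fun i => by fun_prop)
    (hind.comp (fun i x => inner ℝ (u i • v) x) fun i => by fun_prop) fun i => h i _).trans ?_
  apply ENNReal.ofReal_le_ofReal
  apply Real.exp_le_exp.2
  have hu2 : ∑ i, u i ^ 2 = 1 := by
    have := EuclideanSpace.norm_sq_eq u
    simpa [hu] using this.symm
  have hT : ∑ i ∈ T, u i ^ 2 ≤ 1 := hu2 ▸
    Finset.sum_le_sum_of_subset_of_nonneg (Finset.subset_univ T) fun _ _ _ => sq_nonneg _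
  simp only [norm_smul, mul_pow, Real.norm_eq_abs, sq_abs]
  rw [← Finset.sum_div, ← Finset.sum_mul]
  gcongr
  nlinarith [sq_nonneg ‖v‖]

lemma expMoment_diag_le (hr : ∀ i, Measurable (r i)) (hind : iIndepFun r μ) (hs : 0 < s)
    (h : ∀ i (l : ℝ), |l| ≤ s / 2 → expMoment μ (fun ω => l * (‖r i ω‖ ^ 2 - n)) ≤
      ENNReal.ofReal (Real.exp (16 * l ^ 2 / s ^ 2 * n)))
    (u : EuclideanSpace ℝ (Fin m)) (hu : ‖u‖ = 1) {l : ℝ} (hl : |l| ≤ s / 2) :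
    expMoment μ (fun ω => l * (∑ i, ‖u i • r i ω‖ ^ 2 - n)) ≤
      ENNReal.ofReal (Real.exp (16 * l ^ 2 / s ^ 2 * n)) := by
  have hu2 : ∑ i, u i ^ 2 = 1 := by
    have := EuclideanSpace.norm_sq_eq u
    simpa [hu] using this.symm
  have hu1 : ∀ i, u i ^ 2 ≤ 1 := fun i => hu2 ▸
    Finset.single_le_sum (f := fun i => u i ^ 2) (fun _ _ => sq_nonneg _) (Finset.mem_univ i)
  have e : (fun ω => l * (∑ i, ‖u i • r i ω‖ ^ 2 - n)) =
      fun ω => ∑ i, (l * u i ^ 2) * (‖r i ω‖ ^ 2 - n) := by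
    ext ω
    have : (n : ℝ) = ∑ i, u i ^ 2 * n := by rw [← Finset.sum_mul, hu2, one_mul]
    conv_lhs => rw [this]
    rw [← Finset.sum_sub_distrib, Finset.mul_sum]
    refine Finset.sum_congr rfl fun i _ => ?_
    rw [norm_smul, mul_pow, Real.norm_eq_abs, sq_abs]
    ring
  rw [e]
  refine (expMoment_sum_le_of_iIndepFun _ (f := fun i ω => (l * u i ^ 2) * (‖r i ω‖ ^ 2 - n))
    (fun i => by fun_prop)
    (hind.comp (fun i x => (l * u i ^ 2) * (‖x‖ ^ 2 - n)) fun i => by fun_prop)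
    fun i => h i _ ?_).trans ?_
  · rw [abs_mul, abs_of_nonneg (sq_nonneg (u i))]
    exact (mul_le_of_le_one_right (abs_nonneg l) (hu1 i)).trans hl
  · apply ENNReal.ofReal_le_ofReal
    apply Real.exp_le_exp.2
    calc ∑ i, 16 * (l * u i ^ 2) ^ 2 / s ^ 2 * n
        ≤ ∑ i, u i ^ 2 * (16 * l ^ 2 / s ^ 2 * n) := by
          refine Finset.sum_le_sum fun i _ => ?_
          have : 16 * (l * u i ^ 2) ^ 2 / s ^ 2 * n =
            u i ^ 2 * (u i ^ 2 * (16 * l ^ 2 / s ^ 2 * n)) := by ring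
          rw [this]
          exact mul_le_mul_of_nonneg_left (mul_le_of_le_one_left (by positivity) (hu1 i))
            (sq_nonneg _)
      _ = _ := by rw [← Finset.sum_mul, hu2, one_mul]

variable [IsProbabilityMeasure μ]

lemma expMoment_offDiag_le (hr : ∀ i, Measurable (r i)) (hind : iIndepFun r μ) (hs : 0 < s)
    (h : ∀ i (v : EuclideanSpace ℝ (Fin n)),
      expMoment μ (fun ω => inner ℝ v (r i ω)) ≤ ENNReal.ofReal (Real.exp (‖v‖ ^ 2 / s)))
    (u : EuclideanSpace ℝ (Fin m)) (hu : ‖u‖ = 1) {l : ℝ} (hl : 128 * l ^ 2 ≤ s ^ 2) :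
    expMoment μ (fun ω => l * (‖∑ i, u i • r i ω‖ ^ 2 - ∑ i, ‖u i • r i ω‖ ^ 2)) ≤
      ENNReal.ofReal (Real.exp (128 * l ^ 2 / s ^ 2 * n)) := by
  -- The off-diagonal part is the uniform average over `T` of these decoupled forms, so Jensen's
  -- inequality reduces its exponential moment to theirs. With `c = 4l`, the constant `8c²` becomes
  -- `128 l²`.
  let w : Finset (Fin m) → Ω → ℝ := fun T ω =>
    4 * l * inner ℝ (∑ i ∈ T, u i • r i ω) (∑ i ∈ Finset.univ \ T, u i • r i ω)
  have hw : ∀ T, expMoment μ (w T) ≤ ENNReal.ofReal (Real.exp (128 * l ^ 2 / s ^ 2 * n)) := by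
    intro T
    have hTc := (hind.indepFun_finset T (Finset.univ \ T) Finset.disjoint_sdiff hr).comp
      (φ := fun f => ∑ i : T, u i • f i) (ψ := fun f => ∑ i : ↥(Finset.univ \ T), u i • f i)
      (by fun_prop) (by fun_prop)
    have e : ∀ T : Finset (Fin m), ((fun f : T → EuclideanSpace ℝ (Fin n) => ∑ i : T, u i • f i) ∘
        fun ω (i : T) => r i ω) = fun ω => ∑ i ∈ T, u i • r i ω := by
      intro T
      ext1 ω
      exact Finset.sum_coe_sort T fun i => u i • r i ω
    rw [e, e] at hTc
    have := expMoment_mul_inner_le_of_indepFun (c := 4 * l) (by fun_prop) (by fun_prop) hTc hs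
      (expMoment_inner_sum_smul_le hr hind hs h u hu _)
      (expMoment_inner_sum_smul_le hr hind hs h u hu _) (by linarith)
    refine this.trans_eq ?_
    congr 3; ring
  have hcard : (2 : ℝ) ^ (Finset.univ : Finset (Fin m)).card ≠ 0 := by positivity
  have pt : ∀ ω, ENNReal.ofReal
      (Real.exp (l * (‖∑ i, u i • r i ω‖ ^ 2 - ∑ i, ‖u i • r i ω‖ ^ 2))) ≤
      ∑ T ∈ (Finset.univ : Finset (Fin m)).powerset, ENNReal.ofReal
        ((2 ^ (Finset.univ : Finset (Fin m)).card)⁻¹) * ENNReal.ofReal (Real.exp (w T ω)) := by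
    intro ω
    have hd := four_mul_sum_powerset_inner (fun i => u i • r i ω) Finset.univ
    have e : l * (‖∑ i, u i • r i ω‖ ^ 2 - ∑ i, ‖u i • r i ω‖ ^ 2) =
        ∑ T ∈ (Finset.univ : Finset (Fin m)).powerset,
          (2 ^ (Finset.univ : Finset (Fin m)).card : ℝ)⁻¹ • w T ω := by
      simp only [w]
      rw [← Finset.smul_sum, ← Finset.mul_sum, mul_right_comm, hd, smul_eq_mul]
      field_simp
    have hJ := convexOn_exp.map_sum_le (t := (Finset.univ : Finset (Fin m)).powerset)
      (w := fun _ => (2 ^ (Finset.univ : Finset (Fin m)).card : ℝ)⁻¹) (p := fun T => w T ω)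
      (fun _ _ => by positivity)
      (by rw [Finset.sum_const, Finset.card_powerset, nsmul_eq_mul]; push_cast; field_simp)
      (fun _ _ => Set.mem_univ _)
    rw [e]
    refine (ENNReal.ofReal_le_ofReal hJ).trans_eq ?_
    rw [ENNReal.ofReal_sum_of_nonneg fun _ _ => by positivity]
    refine Finset.sum_congr rfl fun T _ => ?_
    rw [smul_eq_mul, ENNReal.ofReal_mul (by positivity)]
  calc _ ≤ ∫⁻ ω, ∑ T ∈ (Finset.univ : Finset (Fin m)).powerset, ENNReal.ofReal
        ((2 ^ (Finset.univ : Finset (Fin m)).card)⁻¹) * ENNReal.ofReal (Real.exp (w T ω)) ∂μ :=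
        lintegral_mono pt
    _ = ∑ T ∈ (Finset.univ : Finset (Fin m)).powerset, ENNReal.ofReal
        ((2 ^ (Finset.univ : Finset (Fin m)).card)⁻¹) * expMoment μ (w T) := by
        rw [lintegral_finsetSum _ fun T _ => by fun_prop]
        exact Finset.sum_congr rfl fun T _ => lintegral_const_mul' _ _ (by simp)
    _ ≤ ∑ T ∈ (Finset.univ : Finset (Fin m)).powerset, ENNReal.ofReal
        ((2 ^ (Finset.univ : Finset (Fin m)).card)⁻¹) *
          ENNReal.ofReal (Real.exp (128 * l ^ 2 / s ^ 2 * n)) := by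
        gcongr with T _; exact hw T
    _ = _ := by
        rw [Finset.sum_const, Finset.card_powerset, nsmul_eq_mul, ← mul_assoc,
          ← ENNReal.ofReal_natCast, ← ENNReal.ofReal_mul (by positivity)]
        push_cast
        rw [mul_inv_cancel₀ hcard]
        simp

lemma expMoment_norm_sq_sum_sub_le (hr : ∀ i, Measurable (r i)) (hind : iIndepFun r μ) (hs : 0 < s)
    (h : ∀ i (v : EuclideanSpace ℝ (Fin n)),
      expMoment μ (fun ω => inner ℝ v (r i ω)) ≤ ENNReal.ofReal (Real.exp (‖v‖ ^ 2 / s)))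
    (h' : ∀ i (l : ℝ), |l| ≤ s / 2 → expMoment μ (fun ω => l * (‖r i ω‖ ^ 2 - n)) ≤
      ENNReal.ofReal (Real.exp (16 * l ^ 2 / s ^ 2 * n)))
    (u : EuclideanSpace ℝ (Fin m)) (hu : ‖u‖ = 1) {l : ℝ} (hl : 512 * l ^ 2 ≤ s ^ 2) :
    expMoment μ (fun ω => l * (‖∑ i, u i • r i ω‖ ^ 2 - n)) ≤
      ENNReal.ofReal (Real.exp (512 * l ^ 2 / s ^ 2 * n)) := by
  -- The diagonal and off-diagonal parts are dependent, so they are separated by `exp((f + g)/2) ≤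
  -- (exp f + exp g)/2`, at the price of doubling `l`.
  have h1 := expMoment_offDiag_le hr hind hs h u hu (l := 2 * l) (by linarith)
  have h2 := expMoment_diag_le hr hind hs h' u hu (l := 2 * l)
    (abs_le_of_sq_le_sq (by nlinarith) (by positivity))
  have h2' : ENNReal.ofReal (Real.exp (16 * (2 * l) ^ 2 / s ^ 2 * n)) ≤
      ENNReal.ofReal (Real.exp (512 * l ^ 2 / s ^ 2 * n)) := by
    apply ENNReal.ofReal_le_ofReal
    apply Real.exp_le_exp.2
    gcongr ?_ / _ * _
    nlinarith [sq_nonneg l]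
  rw [show 128 * (2 * l) ^ 2 = 512 * l ^ 2 by ring] at h1
  set f := fun ω => 2 * l * (‖∑ i, u i • r i ω‖ ^ 2 - ∑ i, ‖u i • r i ω‖ ^ 2) with hf
  set g := fun ω => 2 * l * (∑ i, ‖u i • r i ω‖ ^ 2 - n) with hg
  have hfm : Measurable f := by fun_prop
  have pt : ∀ ω, ENNReal.ofReal (Real.exp (l * (‖∑ i, u i • r i ω‖ ^ 2 - n))) ≤
      ENNReal.ofReal (1 / 2) * (ENNReal.ofReal (Real.exp (f ω)) + ENNReal.ofReal (Real.exp (g ω))) := by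
    intro ω
    rw [← ENNReal.ofReal_add (by positivity) (by positivity), ← ENNReal.ofReal_mul (by norm_num)]
    apply ENNReal.ofReal_le_ofReal
    have := convexOn_exp.2 (Set.mem_univ (f ω)) (Set.mem_univ (g ω))
      (by norm_num : (0 : ℝ) ≤ 1 / 2) (by norm_num : (0 : ℝ) ≤ 1 / 2) (by norm_num)
    simp only [smul_eq_mul] at this
    have e : 1 / 2 * f ω + 1 / 2 * g ω = l * (‖∑ i, u i • r i ω‖ ^ 2 - n) := by
      simp only [hf, hg]; ring
    rw [e] at this
    linarith
  calc _ ≤ _ := lintegral_mono pt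
    _ = ENNReal.ofReal (1 / 2) * (expMoment μ f + expMoment μ g) := by
        rw [lintegral_const_mul' _ _ (by simp), lintegral_add_left (by fun_prop)]
        rfl
    _ ≤ ENNReal.ofReal (1 / 2) * (ENNReal.ofReal (Real.exp (512 * l ^ 2 / s ^ 2 * n)) +
          ENNReal.ofReal (Real.exp (512 * l ^ 2 / s ^ 2 * n))) := by
        gcongr; exact h2.trans h2'
    _ = _ := by
        rw [← ENNReal.ofReal_add (by positivity) (by positivity),
          ← ENNReal.ofReal_mul (by norm_num)]
        congr 1; ring

end Rows

lemma toEuclideanLin_rowMatrix_transpose {m n : ℕ} (r : Fin m → EuclideanSpace ℝ (Fin n))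
    (u : EuclideanSpace ℝ (Fin m)) :
    Matrix.toEuclideanLin (rowMatrix r).transpose u = ∑ i, u i • r i := by
  ext j
  simp [rowMatrix, Matrix.toLpLin_apply, Matrix.mulVec, dotProduct, mul_comm]

lemma norm_sq_toEuclideanLin_rowMatrix {m n : ℕ} (r : Fin m → EuclideanSpace ℝ (Fin n))
    (x : EuclideanSpace ℝ (Fin n)) :
    ‖Matrix.toEuclideanLin (rowMatrix r) x‖ ^ 2 = ∑ i, inner ℝ x (r i) ^ 2 := by
  rw [EuclideanSpace.norm_sq_eq]
  refine Finset.sum_congr rfl fun i _ => ?_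
  rw [Real.norm_eq_abs, sq_abs]
  simp [rowMatrix, Matrix.toLpLin_apply, Matrix.mulVec, dotProduct, PiLp.inner_apply]

/-! ### Tail bounds and the union bound. -/

section Concentration

variable {Ω : Type*} [MeasurableSpace Ω] {μ : Measure Ω}
  {m n : ℕ} {s : ℝ} {r : Fin m → Ω → EuclideanSpace ℝ (Fin n)}

lemma measure_sum_inner_sq_ge_le (hr : ∀ i, Measurable (r i)) (hind : iIndepFun r μ)
    (hs : 0 < s) (hs1 : s ≤ 1) (x : EuclideanSpace ℝ (Fin n))
    (h : ∀ i (l : ℝ), |l| ≤ s / 2 → expMoment μ (fun ω => l * (inner ℝ x (r i ω) ^ 2 - 1)) ≤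
      ENNReal.ofReal (Real.exp (16 * l ^ 2 / s ^ 2))) :
    μ {ω | 1.3 * (m : ℝ) ≤ ∑ i, inner ℝ x (r i ω) ^ 2} ≤
      ENNReal.ofReal (Real.exp (-(s ^ 2 / 800) * m)) := by
  have hsub : {ω | 1.3 * (m : ℝ) ≤ ∑ i, inner ℝ x (r i ω) ^ 2} ⊆
      -- With `l = s²/160` the Chernoff exponent per row is `-0.3 l + 16 l²/s² = -s²/800`; `s ≤ 1`
      -- ensures `l ≤ s/2`.
      {ω | s ^ 2 / 160 * (0.3 * m) ≤ ∑ i, s ^ 2 / 160 * (inner ℝ x (r i ω) ^ 2 - 1)} := by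
    intro ω hω
    simp only [Set.mem_ofPred_eq] at hω ⊢
    rw [← Finset.mul_sum, Finset.sum_sub_distrib]
    gcongr
    simp
    linarith
  refine (measure_mono hsub).trans
    ((measure_ge_le_exp_mul_expMoment (by fun_prop) _).trans ?_)
  have := expMoment_sum_le_of_iIndepFun Finset.univ
    (f := fun i ω => s ^ 2 / 160 * (inner ℝ x (r i ω) ^ 2 - 1)) (fun i => by fun_prop)
    (hind.comp (fun i y => s ^ 2 / 160 * (inner ℝ x y ^ 2 - 1)) fun i => by fun_prop)
    (fun i => h i _ (by rw [abs_of_nonneg (by positivity)]; nlinarith))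
  refine (mul_le_mul_right this _).trans_eq ?_
  rw [← ENNReal.ofReal_mul (Real.exp_pos _).le, ← Real.exp_add]
  simp only [Finset.sum_const, Finset.card_univ, Fintype.card_fin, nsmul_eq_mul]
  congr 2
  field_simp
  ring

variable [IsProbabilityMeasure μ]

lemma measure_norm_sq_sum_deviation_le (hr : ∀ i, Measurable (r i)) (hind : iIndepFun r μ)
    (hs : 0 < s) (hs1 : s ≤ 1)
    (h : ∀ i (v : EuclideanSpace ℝ (Fin n)),
      expMoment μ (fun ω => inner ℝ v (r i ω)) ≤ ENNReal.ofReal (Real.exp (‖v‖ ^ 2 / s)))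
    (h' : ∀ i (l : ℝ), |l| ≤ s / 2 → expMoment μ (fun ω => l * (‖r i ω‖ ^ 2 - n)) ≤
      ENNReal.ofReal (Real.exp (16 * l ^ 2 / s ^ 2 * n)))
    (u : EuclideanSpace ℝ (Fin m)) (hu : ‖u‖ = 1) :
    μ {ω | (n : ℝ) / 10 < |‖∑ i, u i • r i ω‖ ^ 2 - n|} ≤
      ENNReal.ofReal (2 * Real.exp (-(s ^ 2 / 204800) * n)) := by
  have hs2 : s ^ 2 ≤ 1 := pow_le_one₀ hs.le hs1
  -- The value `|l| = s²/10240` minimizes `-|l|/10 + 512 l²/s²`, the minimum being `-s²/204800`. The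
  -- two signs of `l` give the two tails.
  have tail : ∀ l : ℝ, |l| = s ^ 2 / 10240 →
      μ {ω | |l| * (n / 10) ≤ l * (‖∑ i, u i • r i ω‖ ^ 2 - n)} ≤
        ENNReal.ofReal (Real.exp (-(s ^ 2 / 204800) * n)) := by
    intro l hl
    have hl2 : l ^ 2 = (s ^ 2 / 10240) ^ 2 := by rw [← sq_abs, hl]
    refine (measure_ge_le_exp_mul_expMoment (by fun_prop) _).trans ?_
    refine (mul_le_mul_right (expMoment_norm_sq_sum_sub_le hr hind hs h h' u hu (l := l)
      (by rw [hl2]; nlinarith [sq_nonneg s])) _).trans_eq ?_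
    rw [← ENNReal.ofReal_mul (Real.exp_pos _).le, ← Real.exp_add, hl, hl2]
    congr 2
    field_simp
    ring
  have hpos : (0 : ℝ) ≤ s ^ 2 / 10240 := by positivity
  have hsub : {ω | (n : ℝ) / 10 < |‖∑ i, u i • r i ω‖ ^ 2 - n|} ⊆
      {ω | |s ^ 2 / 10240| * (n / 10) ≤ s ^ 2 / 10240 * (‖∑ i, u i • r i ω‖ ^ 2 - n)} ∪
      {ω | |-(s ^ 2 / 10240)| * (n / 10) ≤ -(s ^ 2 / 10240) * (‖∑ i, u i • r i ω‖ ^ 2 - n)} := by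
    intro ω hω
    simp only [Set.mem_union, Set.mem_ofPred_eq, abs_neg, abs_of_nonneg hpos] at hω ⊢
    rcases lt_abs.1 hω with hω | hω
    · left
      gcongr
    · right
      rw [neg_mul_comm]
      gcongr
  refine (measure_mono hsub).trans ((measure_union_le _ _).trans ?_)
  refine (add_le_add (tail _ (abs_of_nonneg hpos))
    (tail _ (by rw [abs_neg, abs_of_nonneg hpos]))).trans_eq ?_
  rw [← ENNReal.ofReal_add (by positivity) (by positivity)]
  congr 1; ring

lemma measure_not_good_le (hr : ∀ i, Measurable (r i)) (hind : iIndepFun r μ)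
    (hs : 0 < s) (hs1 : s ≤ 1)
    (h : ∀ i (v : EuclideanSpace ℝ (Fin n)),
      expMoment μ (fun ω => inner ℝ v (r i ω)) ≤ ENNReal.ofReal (Real.exp (‖v‖ ^ 2 / s)))
    (h' : ∀ i (l : ℝ), |l| ≤ s / 2 → expMoment μ (fun ω => l * (‖r i ω‖ ^ 2 - n)) ≤
      ENNReal.ofReal (Real.exp (16 * l ^ 2 / s ^ 2 * n)))
    (x : EuclideanSpace ℝ (Fin n))
    (hx : ∀ i (l : ℝ), |l| ≤ s / 2 → expMoment μ (fun ω => l * (inner ℝ x (r i ω) ^ 2 - 1)) ≤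
      ENNReal.ofReal (Real.exp (16 * l ^ 2 / s ^ 2)))
    (hm : 0 < m) (hmn : (m : ℝ) ≤ s ^ 2 / 1024000 * n) :
    μ {ω | ¬ (0 < sigmaMin (rowMatrix fun i => r i ω).transpose ∧
        ‖Matrix.toEuclideanLin (rowMatrix fun i => r i ω) x‖ ^ 2 /
          sigmaMin (rowMatrix fun i => r i ω).transpose ^ 2 ≤ 2 * m / n)} ≤
      ENNReal.ofReal (4 * Real.exp (-(s ^ 2 / 800) * m)) := by
  have hs2 : s ^ 2 ≤ 1 := pow_le_one₀ hs.le hs1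
  have hm' : (0 : ℝ) < m := by exact_mod_cast hm
  have hn : (0 : ℝ) < n := by
    by_contra! hcon
    nlinarith [sq_nonneg s]
  have hmn' : m ≤ n := by
    have : (m : ℝ) ≤ n := by nlinarith
    exact_mod_cast this
  obtain ⟨N, hcard, hunit, hnet⟩ := exists_net_unit_sphere (E := EuclideanSpace ℝ (Fin m))
  rw [finrank_euclideanSpace_fin] at hcard
  have hsub : {ω | ¬ (0 < sigmaMin (rowMatrix fun i => r i ω).transpose ∧
        ‖Matrix.toEuclideanLin (rowMatrix fun i => r i ω) x‖ ^ 2 /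
          sigmaMin (rowMatrix fun i => r i ω).transpose ^ 2 ≤ 2 * m / n)} ⊆
      (⋃ u ∈ N, {ω | (n : ℝ) / 10 < |‖∑ i, u i • r i ω‖ ^ 2 - n|}) ∪
        {ω | 1.3 * (m : ℝ) ≤ ∑ i, inner ℝ x (r i ω) ^ 2} := by
    intro ω hω
    by_contra hcon
    apply hω
    simp only [Set.mem_union, Set.mem_iUnion, Set.mem_ofPred_eq, not_or, not_exists, not_lt,
      not_le] at hcon
    obtain ⟨hA, hB⟩ := hcon
    have hlow := lower_bound_of_net (ρ := √n) (LinearMap.toContinuousLinearMap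
      (Matrix.toEuclideanLin (rowMatrix fun i => r i ω).transpose)) hnet (Real.sqrt_nonneg _)
      fun c hc => by
        rw [LinearMap.coe_toContinuousLinearMap', toEuclideanLin_rowMatrix_transpose,
          Real.sq_sqrt hn.le]
        exact hA c hc
    have hσ := le_sigmaMin_of_le_norm _ hm hmn' hlow
    have hσ0 : 0 < 83 / 100 * √(n : ℝ) := by positivity
    refine ⟨hσ0.trans_le hσ, ?_⟩
    rw [norm_sq_toEuclideanLin_rowMatrix,
      div_le_div_iff₀ (by have := hσ0.trans_le hσ; positivity) hn]
    have hσ2 : (83 / 100) ^ 2 * (n : ℝ) ≤ sigmaMin (rowMatrix fun i => r i ω).transpose ^ 2 := by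
      have := pow_le_pow_left₀ hσ0.le hσ 2
      rwa [mul_pow, Real.sq_sqrt hn.le] at this
    calc (∑ i, inner ℝ x (r i ω) ^ 2) * (n : ℝ) ≤ 1.3 * m * n := by gcongr
      _ ≤ 2 * m * ((83 / 100) ^ 2 * n) := by nlinarith [mul_pos hm' hn]
      _ ≤ _ := by gcongr
  have hnetm : μ (⋃ u ∈ N, {ω | (n : ℝ) / 10 < |‖∑ i, u i • r i ω‖ ^ 2 - n|}) ≤
      ENNReal.ofReal (2 * Real.exp (-(s ^ 2 / 800) * m)) := by
    calc _ ≤ ∑ u ∈ N, μ {ω | (n : ℝ) / 10 < |‖∑ i, u i • r i ω‖ ^ 2 - n|} :=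
          measure_biUnion_finset_le _ _
      _ ≤ ∑ u ∈ N, ENNReal.ofReal (2 * Real.exp (-(s ^ 2 / 204800) * n)) :=
          Finset.sum_le_sum fun u hu =>
            measure_norm_sq_sum_deviation_le hr hind hs hs1 h h' u (hunit u hu)
      _ = ENNReal.ofReal (N.card * (2 * Real.exp (-(s ^ 2 / 204800) * n))) := by
          rw [Finset.sum_const, nsmul_eq_mul, ← ENNReal.ofReal_natCast,
            ← ENNReal.ofReal_mul (by positivity)]
      _ ≤ _ := by
          apply ENNReal.ofReal_le_ofReal
          -- The net costs `e^(4m)`, while the hypothesis on `m` gives `(s²/204800) n ≥ 5m`. The net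
          -- event thus has probability at most `2e^(-m)`, which suffices since `s²/800 ≤ 1`.
          have h21 : (N.card : ℝ) ≤ Real.exp (4 * m) := by
            have e1 : (N.card : ℝ) ≤ 21 ^ m := by exact_mod_cast hcard
            have e2 : (21 : ℝ) ≤ Real.exp 4 := by
              have : Real.exp 4 = Real.exp 1 ^ 4 := by rw [← Real.exp_nat_mul]; norm_num
              rw [this]
              have := Real.exp_one_gt_d9
              calc (21 : ℝ) ≤ 2.7 ^ 4 := by norm_num
                _ ≤ _ := by gcongr; linarith
            calc (N.card : ℝ) ≤ 21 ^ m := e1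
              _ ≤ Real.exp 4 ^ m := by gcongr
              _ = _ := by rw [← Real.exp_nat_mul, mul_comm]
          calc (N.card : ℝ) * (2 * Real.exp (-(s ^ 2 / 204800) * n))
              ≤ Real.exp (4 * m) * (2 * Real.exp (-(s ^ 2 / 204800) * n)) := by gcongr
            _ = 2 * Real.exp (4 * m + -(s ^ 2 / 204800) * n) := by rw [Real.exp_add]; ring
            _ ≤ _ := by
                gcongr
                nlinarith
  refine (measure_mono hsub).trans ((measure_union_le _ _).trans
    ((add_le_add hnetm (measure_sum_inner_sq_ge_le hr hind hs hs1 x hx)).trans ?_))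
  rw [← ENNReal.ofReal_add (by positivity) (by positivity)]
  apply ENNReal.ofReal_le_ofReal
  linarith [Real.exp_pos (-(s ^ 2 / 800) * m)]

end Concentration

/-! ### From the assumptions on `a` to the moment bounds on a row. -/

section RowLaw

variable {Ω : Type*} [MeasurableSpace Ω] {ν : Measure Ω} {n : ℕ}
  {a : Ω → EuclideanSpace ℝ (Fin n)}

/-- The strict inequality `K < L` replaces the infimum defining the norm by an admissible constant
below `L`, so attainment need not be shown. -/
lemma eLpNorm_inner_le_of_subgaussianNormVec_le {K L : ℝ}
    (h : subgaussianNormVec a ν ≤ ENNReal.ofReal K) (hKL : K < L) (hL : 0 < L)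
    {v : EuclideanSpace ℝ (Fin n)} (hv : ‖v‖ = 1) {p : ℝ} (hp : 1 ≤ p) :
    eLpNorm (fun ω => inner ℝ v (a ω)) (ENNReal.ofReal p) ν ≤ ENNReal.ofReal (L * √p) := by
  have h1 : subgaussianNorm (fun ω => inner ℝ v (a ω)) ν < ENNReal.ofReal L :=
    ((le_iSup₂ (f := fun (v : EuclideanSpace ℝ (Fin n)) (_ : ‖v‖ = 1) =>
      subgaussianNorm (fun ω => inner ℝ v (a ω)) ν) v hv).trans h).trans_lt
      ((ENNReal.ofReal_lt_ofReal_iff hL).2 hKL)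
  obtain ⟨M, hM, hML⟩ := sInf_lt_iff.1 h1
  refine (hM p hp).trans ?_
  rw [ENNReal.ofReal_mul hL.le]
  gcongr

lemma integral_inner_eq_zero (hint : ∀ j, Integrable (fun ω => a ω j) ν)
    (h0 : ∀ j, ∫ ω, a ω j ∂ν = 0) (v : EuclideanSpace ℝ (Fin n)) :
    ∫ ω, inner ℝ v (a ω) ∂ν = 0 := by
  simp only [PiLp.inner_apply]
  rw [integral_finsetSum]
  · refine Finset.sum_eq_zero fun j _ => ?_
    simp [integral_mul_const, h0]
  · intro j _
    simpa using (hint j).mul_const (v j)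

lemma integral_inner_sq_of_isIsotropic (hint : ∀ i j, Integrable (fun ω => a ω i * a ω j) ν)
    (h : IsIsotropic a ν) (v : EuclideanSpace ℝ (Fin n)) :
    ∫ ω, inner ℝ v (a ω) ^ 2 ∂ν = ‖v‖ ^ 2 := by
  have hij : ∀ i j, ∫ ω, a ω i * a ω j ∂ν = if i = j then 1 else 0 := fun i j => by
    have := congrFun (congrFun h i) j
    rwa [Matrix.of_apply, Matrix.one_apply] at this
  have e : ∀ ω, inner ℝ v (a ω) ^ 2 = ∑ i, ∑ j, v i * v j * (a ω i * a ω j) := fun ω => by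
    rw [PiLp.inner_apply, sq, Finset.sum_mul_sum]
    refine Finset.sum_congr rfl fun i _ => Finset.sum_congr rfl fun j _ => ?_
    simp; ring
  simp_rw [e]
  rw [integral_finsetSum _ fun i _ => integrable_finsetSum _ fun j _ => (hint i j).const_mul _]
  have : ∀ i, ∫ ω, ∑ j, v i * v j * (a ω i * a ω j) ∂ν = v i ^ 2 := fun i => by
    rw [integral_finsetSum _ fun j _ => (hint i j).const_mul _]
    simp [integral_const_mul, hij, sq]
  simp_rw [this]
  rw [EuclideanSpace.norm_sq_eq]
  simp

lemma IsIndepSubgaussianRow.isIsotropic (h : IsIndepSubgaussianRow a ν) (ha : AEMeasurable a ν) :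
    IsIsotropic a ν := by
  have ham : ∀ j, AEMeasurable (fun ω => a ω j) ν := fun j => by fun_prop
  ext i j
  rw [Matrix.of_apply, Matrix.one_apply]
  split_ifs with hij
  · subst hij
    have := h.unit_variance i
    rw [variance_of_integral_eq_zero (ham i) (h.zero_mean i)] at this
    simpa [sq] using this
  · rw [(h.indep.indepFun hij).integral_fun_mul_eq_mul_integral (ham i).aestronglyMeasurable
      (ham j).aestronglyMeasurable, h.zero_mean i, zero_mul]

variable [IsProbabilityMeasure ν] {s : ℝ}

lemma integral_inner_eq_zero_and_sq (ha : AEMeasurable a ν) (hs : 0 < s)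
    (h : ∀ v : EuclideanSpace ℝ (Fin n), ‖v‖ = 1 →
      expMoment ν (fun ω => s * inner ℝ v (a ω) ^ 2) ≤ 2)
    (hrow : IsSphericalSubgaussianRow a ν ∨ IsIndepSubgaussianRow a ν)
    (v : EuclideanSpace ℝ (Fin n)) :
    ∫ ω, inner ℝ v (a ω) ∂ν = 0 ∧ ∫ ω, inner ℝ v (a ω) ^ 2 ∂ν = ‖v‖ ^ 2 := by
  have hc : ∀ j, expMoment ν (fun ω => s * a ω j ^ 2) ≤ 2 := fun j => by
    simpa [EuclideanSpace.inner_single_left] using h (EuclideanSpace.single j 1) (by simp)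
  have hm : ∀ j, AEMeasurable (fun ω => a ω j) ν := fun j => by fun_prop
  have h2 : ∀ j, MemLp (fun ω => a ω j) 2 ν := fun j =>
    (memLp_two_iff_integrable_sq (hm j).aestronglyMeasurable).2
      (integrable_sq_of_expMoment (hm j) hs (hc j))
  refine ⟨integral_inner_eq_zero (fun j => integrable_of_expMoment (hm j) hs (hc j))
    (hrow.elim (·.zero_mean) (·.zero_mean)) v,
    integral_inner_sq_of_isIsotropic (fun i j => (h2 i).integrable_mul (h2 j))
      (hrow.elim (·.isotropic) (·.isIsotropic ha)) v⟩

lemma expMoment_inner_le (ha : AEMeasurable a ν) (hs : 0 < s)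
    (h : ∀ v : EuclideanSpace ℝ (Fin n), ‖v‖ = 1 →
      expMoment ν (fun ω => s * inner ℝ v (a ω) ^ 2) ≤ 2)
    (h0 : ∀ v : EuclideanSpace ℝ (Fin n), ∫ ω, inner ℝ v (a ω) ∂ν = 0)
    (v : EuclideanSpace ℝ (Fin n)) :
    expMoment ν (fun ω => inner ℝ v (a ω)) ≤ ENNReal.ofReal (Real.exp (‖v‖ ^ 2 / s)) := by
  rcases eq_or_ne v 0 with rfl | hv
  · simp [expMoment]
  have hv' : ‖v‖ ≠ 0 := norm_ne_zero_iff.2 hv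
  have := expMoment_mul_le_of_centered (by fun_prop) hs
    (h (‖v‖⁻¹ • v) (by rw [norm_smul, norm_inv, norm_norm, inv_mul_cancel₀ hv'])) (h0 _) ‖v‖
  simpa [real_inner_smul_left, mul_inv_cancel_left₀ hv'] using this

lemma expMoment_norm_sq_sub_le (ha : AEMeasurable a ν) (hs : 0 < s)
    (h : ∀ v : EuclideanSpace ℝ (Fin n), ‖v‖ = 1 →
      expMoment ν (fun ω => s * inner ℝ v (a ω) ^ 2) ≤ 2)
    (h1 : ∀ v : EuclideanSpace ℝ (Fin n), ∫ ω, inner ℝ v (a ω) ^ 2 ∂ν = ‖v‖ ^ 2)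
    (hrow : IsSphericalSubgaussianRow a ν ∨ IsIndepSubgaussianRow a ν) {l : ℝ}
    (hl : |l| ≤ s / 2) :
    expMoment ν (fun ω => l * (‖a ω‖ ^ 2 - n)) ≤
      ENNReal.ofReal (Real.exp (16 * l ^ 2 / s ^ 2 * n)) := by
  rcases hrow with hrow | hrow
  · have : expMoment ν (fun ω => l * (‖a ω‖ ^ 2 - n)) = 1 := by
      have e : ∀ᵐ ω ∂ν, ENNReal.ofReal (Real.exp (l * (‖a ω‖ ^ 2 - n))) = 1 := by
        filter_upwards [hrow.norm_eq] with ω hω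
        rw [hω, Real.sq_sqrt (by positivity)]
        simp
      rw [expMoment, lintegral_congr_ae e]
      simp
    rw [this, ENNReal.one_le_ofReal]
    exact Real.one_le_exp (by positivity)
  -- The entries of `a` are only almost everywhere measurable, so independence is moved to the
  -- coordinates under the law of `a`.
  · have hP := Measure.isProbabilityMeasure_map (μ := ν) ha
    have hind : iIndepFun (fun (j : Fin n) (x : EuclideanSpace ℝ (Fin n)) => x j) (ν.map a) := by
      rw [iIndepFun_iff_map_fun_eq_pi_map fun j => by fun_prop]
      have hpi := (iIndepFun_iff_map_fun_eq_pi_map fun j => by fun_prop).1 hrow.indep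
      rw [AEMeasurable.map_map_of_aemeasurable (by fun_prop) ha]
      refine Eq.trans hpi ?_
      congr 1
      ext1 j
      rw [AEMeasurable.map_map_of_aemeasurable (by fun_prop) ha]
      rfl
    have hmap : ∀ f : EuclideanSpace ℝ (Fin n) → ℝ, Measurable f →
        expMoment (ν.map a) f = expMoment ν (fun ω => f (a ω)) := fun f hf =>
      lintegral_map' (by fun_prop) ha
    have e : ∀ x : EuclideanSpace ℝ (Fin n),
        l * (‖x‖ ^ 2 - n) = ∑ j, l * (x j ^ 2 - 1) := fun x => by
      rw [← Finset.mul_sum, Finset.sum_sub_distrib, EuclideanSpace.norm_sq_eq]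
      simp
    rw [← hmap (fun x => l * (‖x‖ ^ 2 - n)) (by fun_prop)]
    simp_rw [e]
    refine (expMoment_sum_le_of_iIndepFun _
      (f := fun j (x : EuclideanSpace ℝ (Fin n)) => l * (x j ^ 2 - 1)) (fun j => by fun_prop)
      (hind.comp (fun j x => l * (x ^ 2 - 1)) fun j => by fun_prop)
      (b := fun _ => 16 * l ^ 2 / s ^ 2) fun j => ?_).trans_eq ?_
    · rw [hmap (fun x => l * (x j ^ 2 - 1)) (by fun_prop)]
      refine expMoment_mul_sq_sub_one_le (by fun_prop) hs ?_ ?_ hl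
      · simpa [EuclideanSpace.inner_single_left] using h (EuclideanSpace.single j 1) (by simp)
      · simpa [EuclideanSpace.inner_single_left] using h1 (EuclideanSpace.single j 1)
    · simp [mul_comm]

end RowLaw

/-! ### Choice of constants and transfer to the given rows. -/

theorem mainTheorem9 (K : ℝ) :
    ∃ c₁ c₂ : ℝ, 0 < c₁ ∧ 0 < c₂ ∧
      ∀ (m n : ℕ)
        -- the random vector of which every row is a copy
        (Ω' : Type*) [MeasurableSpace Ω'] (ν : Measure Ω') [IsProbabilityMeasure ν]
        (a : Ω' → EuclideanSpace ℝ (Fin n))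
        -- the rows of the random matrix `A`
        (Ω : Type*) [MeasurableSpace Ω] (μ : Measure Ω) [IsProbabilityMeasure μ]
        (r : Fin m → Ω → EuclideanSpace ℝ (Fin n))
        (x₀ : EuclideanSpace ℝ (Fin n)),
        AEMeasurable a ν →
        (IsSphericalSubgaussianRow a ν ∨ IsIndepSubgaussianRow a ν) →
        subgaussianNormVec a ν ≤ ENNReal.ofReal K →
        iIndepFun r μ →
        (∀ i : Fin m, IdentDistrib (r i) a μ ν) →
        x₀ ≠ 0 →
        (m : ℝ) ≤ c₁ * n →
        1 - 4 * Real.exp (-c₂ * m) ≤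
          μ.real {ω | 0 < sigmaMin (rowMatrix fun i => r i ω).transpose ∧
            ‖Matrix.toEuclideanLin (rowMatrix fun i => r i ω) (NormedSpace.normalize x₀)‖ ^ 2 /
              sigmaMin (rowMatrix fun i => r i ω).transpose ^ 2 ≤ 2 * m / n} := by
  -- Adding `1` gives both the strict bound `K < L` and `L ≥ 1`, hence `s ≤ 1`, also for nonpositive
  -- `K`.
  set L : ℝ := max K 0 + 1 with hL
  have hKL : K < L := by rw [hL]; linarith [le_max_left K 0]
  have hL1 : 1 ≤ L := by rw [hL]; linarith [le_max_right K 0]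
  have hL0 : 0 < L := by linarith
  set s : ℝ := 1 / (4 * Real.exp 1 * L ^ 2) with hsdef
  have hs : 0 < s := by positivity
  have hs1 : s ≤ 1 := by
    rw [hsdef, div_le_one (by positivity)]
    nlinarith [Real.add_one_le_exp (1 : ℝ), one_le_pow₀ hL1 (n := 2)]
  refine ⟨s ^ 2 / 1024000, s ^ 2 / 800, by positivity, by positivity, ?_⟩
  intro m n Ω' _ ν _ a Ω _ μ _ r x₀ ha hrow hnorm hind hid hx₀ hmn
  rcases Nat.eq_zero_or_pos m with rfl | hm
  -- For `m = 0` the claimed lower bound is `1 - 4 < 0`.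
  · exact le_trans (by norm_num) measureReal_nonneg
  have hsq : ∀ v : EuclideanSpace ℝ (Fin n), ‖v‖ = 1 →
      expMoment ν (fun ω => s * inner ℝ v (a ω) ^ 2) ≤ 2 := fun v hv =>
    expMoment_mul_sq_le_two (by fun_prop) hL0 fun p hp =>
      eLpNorm_inner_le_of_subgaussianNormVec_le hnorm hKL hL0 hv hp
  have hmom := integral_inner_eq_zero_and_sq ha hs hsq hrow
  have hP := Measure.isProbabilityMeasure_map (μ := ν) ha
  -- The joint law of the rows is this product measure, under which the coordinates are genuinely
  -- measurable.
  let Q : Measure (Fin m → EuclideanSpace ℝ (Fin n)) := Measure.pi fun _ => ν.map a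
  have hQind : iIndepFun (fun (i : Fin m) (y : Fin m → EuclideanSpace ℝ (Fin n)) => y i) Q :=
    iIndepFun_pi (μ := fun _ : Fin m => ν.map a) (X := fun _ x => x) fun _ => aemeasurable_id
  have hmarg : ∀ (i : Fin m) (f : EuclideanSpace ℝ (Fin n) → ℝ), Measurable f →
      expMoment Q (fun y => f (y i)) = expMoment ν (fun ω => f (a ω)) := fun i f hf =>
    ((measurePreserving_eval (fun _ : Fin m => ν.map a) i).lintegral_comp
      (f := fun x => ENNReal.ofReal (Real.exp (f x))) (by fun_prop)).trans
      (lintegral_map' (by fun_prop) ha)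
  have hrm : ∀ i, AEMeasurable (r i) μ := fun i => (hid i).aemeasurable_fst
  have hmapr : μ.map (fun ω i => r i ω) = Q := by
    rw [(iIndepFun_iff_map_fun_eq_pi_map hrm).1 hind]
    congr 1
    ext1 i
    exact (hid i).map_eq
  have hx : ‖NormedSpace.normalize x₀‖ = 1 := NormedSpace.norm_normalize hx₀
  have hbad := measure_not_good_le (μ := Q) (r := fun i y => y i) (fun i => by fun_prop) hQind
    hs hs1
    (fun i v => by
      rw [hmarg i (fun z => inner ℝ v z) (by fun_prop)]
      exact expMoment_inner_le ha hs hsq (fun v => (hmom v).1) v)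
    (fun i l hl => by
      rw [hmarg i (fun z => l * (‖z‖ ^ 2 - n)) (by fun_prop)]
      exact expMoment_norm_sq_sub_le ha hs hsq (fun v => (hmom v).2) hrow hl)
    (NormedSpace.normalize x₀)
    (fun i l hl => by
      rw [hmarg i (fun z => l * (inner ℝ (NormedSpace.normalize x₀) z ^ 2 - 1)) (by fun_prop)]
      exact expMoment_mul_sq_sub_one_le (by fun_prop) hs (hsq _ hx)
        (by rw [(hmom _).2, hx, one_pow]) hl)
    hm hmn
  -- The inequality `μ (f⁻¹ S) ≤ (μ.map f) S` holds for every set, and below only subadditivity is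
  -- used, so measurability of `sigmaMin` is never required.
  have hcompl := (Measure.le_map_apply (aemeasurable_pi_lambda _ hrm) _).trans
    ((congrArg (fun M : Measure _ => M _) hmapr).le.trans hbad)
  have hreal := ENNReal.toReal_le_of_le_ofReal (by positivity) hcompl
  have hone := measureReal_union_le (μ := μ)
    {ω | 0 < sigmaMin (rowMatrix fun i => r i ω).transpose ∧
      ‖Matrix.toEuclideanLin (rowMatrix fun i => r i ω) (NormedSpace.normalize x₀)‖ ^ 2 /
        sigmaMin (rowMatrix fun i => r i ω).transpose ^ 2 ≤ 2 * m / n}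
    {ω | ¬ (0 < sigmaMin (rowMatrix fun i => r i ω).transpose ∧
      ‖Matrix.toEuclideanLin (rowMatrix fun i => r i ω) (NormedSpace.normalize x₀)‖ ^ 2 /
        sigmaMin (rowMatrix fun i => r i ω).transpose ^ 2 ≤ 2 * m / n)}
  rw [show ∀ p : Ω → Prop, {ω | p ω} ∪ {ω | ¬ p ω} = Set.univ from
    fun p => Set.union_compl_self _, probReal_univ] at hone
  have : μ.real {ω | ¬ (0 < sigmaMin (rowMatrix fun i => r i ω).transpose ∧
      ‖Matrix.toEuclideanLin (rowMatrix fun i => r i ω) (NormedSpace.normalize x₀)‖ ^ 2 /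
        sigmaMin (rowMatrix fun i => r i ω).transpose ^ 2 ≤ 2 * m / n)} ≤
      4 * Real.exp (-(s ^ 2 / 800) * m) := hreal
  linarith
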